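/- **Setting.** Let $P\ge 1$ processing elements (PEs) $0,\dots,P-1$ generate a random undirected simple graph with vertex set $\{0,\dots,n-1\}$ and $m\le\binom n2$ edges ($G(n,m)$ model) by the following communication-free algorithm. The vertices are divided into $P$ consecutive sections of size $\lfloor n/P\rfloor$ or $\lceil n/P\rceil$. This divides the lower triangular part of the adjacency matrix into $P(P+1)/2$ chunks $(i,j)$, $j\le i$, arranged in a triangular $P\times P$ chunk matrix (chunk $(i,i)$ is triangular, the others are rectangular). PE $i$ outputs the vertices of section $i$ and all sampled edges in the chunks of row $i$ and column $i$. To find the number of edges in each chunk, every PE starts with the whole chunk matrix and $m$ edges, and recursively splits the rows and the columns of the current block into the first $\lceil\cdot/2\rceil$ and the rest; three hypergeometric random variates distribute the number of edges of the block among its four quadrants (the upper right quadrant of a triangular block is empty), and the PE recurses on the quadrants that contain chunks of its own. When a single chunk remains, its edges are drawn uniformly without replacement by a sequential sampling algorithm (Vitter's Method D; Method A once the $k$ remaining elements are to be chosen from at most $13k$) and mapped to edges by offset computations. All random numbers used for a block come from a pseudorandom generator seeded with a hash of that block only, not of the PE, so that PEs visiting the same block draw the same numbers. Hash values are modelled as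 independent uniform random numbers in $[0,1]$. **Running time.** The following cost one step each (real-RAM model; log, exp, powers and binomial coefficients are unit-cost operations): visiting a block of the recursion, each trial of an acceptance–rejection loop, each record scanned by Method A, each edge selected by Method D, and each output vertex. Hypergeometric variates are generated by acceptance–rejection with the standard hat for discrete log-concave distributions, $y\mapsto p\min(1,e^{1+p/2-p|y|})$ around the mode, where $p$ is the probability of the mode. The running time $T_{n,m,P}$ of the generator is the maximum over all PEs of the number of steps that the PE makes ($\infty$ if some PE does not terminate). **Theorem.** The communication-free undirected $G(n,m)$ generator runs in time $\mathcal O((n+m)/P+P)$ with high probability: for every constant $c>0$ there is a constant $C>0$ (depending only on $c$) such that for all integers $n,m\ge 0$ and $P\ge 1$ with $m\le\binom n2$, $$\Pr\Bigl[\,T_{n,m,P}> C\Bigl(\frac{n+m}{P}+P\Bigr)\Bigr]\le P^{-c}.$$ -/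

import Mathlib

open MeasureTheory
open scoped ENNReal

namespace ERGen

/-! ### Step-counted computations -/

/-- A computation with result `val` that takes `time` elementary steps
(`time = ⊤`: it does not terminate). -/
structure Timed (α : Type) where
  val : α
  time : ℕ∞

/-- Sequential composition adds up the steps. -/
instance : Monad Timed where
  pure a := ⟨a, 0⟩
  bind x f := ⟨(f x.val).val, x.time + (f x.val).time⟩

/-- Spend one elementary step. -/
def tick : Timed Unit := ⟨(), 1⟩

open Classical in
/-- An acceptance-rejection loop: perform trial `0`, trial `1`, ... until the first one that is
accepted (`some a`), at one step per trial. -/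
noncomputable def retry (trial : ℕ → Option ℕ) : Timed ℕ :=
  if h : ∃ t, (trial t).isSome then
    ⟨(trial (Nat.find h)).get (Nat.find_spec h), (Nat.find h + 1 : ℕ)⟩
  else ⟨0, ⊤⟩

/-! ### Hypergeometric random variates -/

/-- Probability that a uniform `k`-subset of an `N`-set meets a given `K`-subset in exactly `z`
elements. -/
noncomputable def hypPMF (N K k : ℕ) (z : ℤ) : ℝ :=
  if 0 ≤ z ∧ z ≤ k then
    (K.choose z.toNat : ℝ) * ((N - K).choose (k - z.toNat) : ℝ) / (N.choose k : ℝ)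
  else 0

open Classical in
/-- One trial of the acceptance-rejection method for the (log-concave) hypergeometric distribution,
from four uniform numbers `u v s w`. With `M` the mode, `p` the probability of the mode and
`b = 1 + p / 2`, the number `y` has density proportional to the hat function
`y ↦ min p (p * exp (b - p * y))` on the positive reals; it is given a random sign, shifted by `M`
and rounded, and the result `z` is accepted if `w` times the hat is less than the probability
of `z`. -/
noncomputable def hypTrial (N K k : ℕ) (u v s w : ℝ) : Option ℕ :=
  let M : ℕ := (K + 1) * (k + 1) / (N + 2)
  let p : ℝ := hypPMF N K k M
  let b : ℝ := 1 + p / 2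
  let a : ℝ := u * (1 + b)
  let y : ℝ := if a ≤ b then a / p else (b - Real.log v) / p
  let z : ℤ := if s < 1 / 2 then (M : ℤ) + ⌊y + 1 / 2⌋ else (M : ℤ) - ⌊y + 1 / 2⌋
  if w * min p (p * Real.exp (b - p * y)) < hypPMF N K k z then some z.toNat else none

/-- A hypergeometric variate; the pseudorandom generator supplies the uniform number `U t j` as the
`j`-th number of trial `t`. -/
noncomputable def hypSample (U : ℕ → ℕ → ℝ) (N K k : ℕ) : Timed ℕ :=
  retry fun t => hypTrial N K k (U t 0) (U t 1) (U t 2) (U t 3)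

/-! ### Sequential sampling without replacement (Vitter's algorithm) -/

open Classical in
/-- Vitter's Method A, one step per scanned record: select `k` of the `N` records
`pos, pos + 1, ..., pos + N - 1`. The uniform number `V k` decides which record is selected next
when `k` of them are still missing; `q` is the probability that all records scanned since the last
selection are skipped. -/
noncomputable def methodA (V : ℕ → ℝ) : (N k pos : ℕ) → (q : ℝ) → Timed (List ℕ)
  | 0, _, _, _ => pure []
  | _ + 1, 0, _, _ => pure []
  | N + 1, k + 1, pos, q => do
      tick
      let q' : ℝ := q * (((N + 1 : ℕ) : ℝ) - ((k + 1 : ℕ) : ℝ)) / ((N + 1 : ℕ) : ℝ)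
      if V (k + 1) < q' then methodA V N (k + 1) (pos + 1) q'
      else do
        let rest ← methodA V N k (pos + 1) 1
        pure (pos :: rest)

open Classical in
/-- One acceptance-rejection trial of Vitter's Method D for the number of records that are skipped
before the next selected one, when `k` of `N` records are to be selected. A number `x` with density
`(k / N) * (1 - x / N) ^ (k - 1)` on `[0, N]` is rounded down to `s`, which is accepted if `u` times
the hat is less than the probability `(N - s - 1).choose (k - 1) / N.choose k` of `s`. -/
noncomputable def skipTrial (N k : ℕ) (v u : ℝ) : Option ℕ :=
  let x : ℝ := N * (1 - v ^ ((1 : ℝ) / k))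
  let s : ℕ := ⌊x⌋₊
  let hat : ℝ := (N : ℝ) / ((N : ℝ) - k + 1) * ((k : ℝ) / N * (1 - x / N) ^ (k - 1))
  if s + k ≤ N ∧ u * hat < ((N - s - 1).choose (k - 1) : ℝ) / (N.choose k : ℝ) then some s else none

/-- Vitter's Method D: select `k` of the `N` records `pos, ..., pos + N - 1`, in increasing order.
As long as the sample is sparse (`13 * k < N`), the next skip is found by acceptance-rejection;
otherwise Method A takes over. `U k t j` is the `j`-th uniform number of trial `t` when `k` records
are still missing. -/
noncomputable def methodD (U : ℕ → ℕ → ℕ → ℝ) : (k N pos : ℕ) → Timed (List ℕ)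
  | 0, _, _ => pure []
  | k + 1, N, pos =>
      if N ≤ 13 * (k + 1) then methodA (fun r => U r 0 2) N (k + 1) pos 1
      else do
        let s ← retry fun t => skipTrial N (k + 1) (U (k + 1) t 0) (U (k + 1) t 1)
        tick
        let rest ← methodD U k (N - s - 1) (pos + s + 1)
        pure ((pos + s) :: rest)

/-! ### The triangular chunk matrix and its quadrants -/

/-- First vertex of section `s`, when `n` vertices are divided into `P` consecutive sections
(each of size `⌊n / P⌋` or `⌈n / P⌉`). -/
def secStart (n P s : ℕ) : ℕ := s * n / P

/-- The quadrants that occur in the recursion on the lower triangular `P × P` chunk matrix: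
* `tri a l`: the triangular one with rows and columns `a, ..., a + l - 1`;
* `rect a l c k`: the rectangular one with rows `a, ..., a + l - 1` and columns `c, ..., c + k - 1`
  (below the diagonal). -/
inductive Block : Type
  | tri (a l : ℕ) : Block
  | rect (a l c k : ℕ) : Block

namespace Block

/-- Number of potential edges (entries strictly below the diagonal of the adjacency matrix). -/
def size (n P : ℕ) : Block → ℕ
  | tri a l => (secStart n P (a + l) - secStart n P a).choose 2
  | rect a l c k =>
      (secStart n P (a + l) - secStart n P a) * (secStart n P (c + k) - secStart n P c)

/-- The block contains a chunk of processing element `i`, which is assigned row `i` and column `i`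
of the chunk matrix. -/
def Meets (i : ℕ) : Block → Prop
  | tri a l => a ≤ i ∧ i < a + l
  | rect a l c k => (a ≤ i ∧ i < a + l ∧ 0 < k) ∨ (c ≤ i ∧ i < c + k ∧ 0 < l)

/-- The block is a single chunk. -/
def IsChunk : Block → Prop
  | tri _ l => l = 1
  | rect _ l _ k => l = 1 ∧ k = 1

/-- The four quadrants (upper right, upper left, lower left, lower right), where rows and columns
are split after the first half, rounded up. The upper right quadrant of a triangular block is
empty, its upper left and lower right quadrants are triangular. -/
def quad : Block → Fin 4 → Block
  | tri a l => fun j =>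
      let h := (l + 1) / 2
      match j with
      | 0 => rect 0 0 0 0
      | 1 => tri a h
      | 2 => rect (a + h) (l - h) a h
      | 3 => tri (a + h) (l - h)
  | rect a l c k => fun j =>
      let h := (l + 1) / 2
      let g := (k + 1) / 2
      match j with
      | 0 => rect a h (c + g) (k - g)
      | 1 => rect a h c g
      | 2 => rect (a + h) (l - h) c g
      | 3 => rect (a + h) (l - h) (c + g) (k - g)

/-- Termination measure of the recursion. -/
def weight : Block → ℕ
  | tri _ l => 2 * l
  | rect _ l _ k => l + k

theorem weight_quad_lt {B : Block} {i : ℕ} (h : B.Meets i) (h' : ¬ B.IsChunk) (j : Fin 4) :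
    (B.quad j).weight < B.weight := by
  cases B <;> fin_cases j <;> simp only [Meets, IsChunk, quad, weight] at * <;> omega

/-- Offset computation: the edge that belongs to the entry number `x` of a block. In a rectangular
block the entries are numbered row by row; in a triangular one row `r` starts with number
`r * (r - 1) / 2`. -/
def toEdge (n P : ℕ) : Block → ℕ → Sym2 ℕ
  | tri a _, x =>
      let r := (1 + Nat.sqrt (8 * x + 1)) / 2
      s(secStart n P a + r, secStart n P a + (x - r * (r - 1) / 2))
  | rect a _ c k, x =>
      let w := secStart n P (c + k) - secStart n P c
      s(secStart n P a + x / w, secStart n P c + x % w)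

end Block

/-! ### The communication-free generator -/

/-- The hash values: `ω (B, r, t, j)` is number `j` of trial `t` of draw `r` of the pseudorandom
generator that is seeded with the recursion subtree `B`. The seed does not involve the id of the
processing element, so all elements that visit `B` see the same numbers. -/
abbrev Source : Type := Block × ℕ × ℕ × ℕ → unitInterval

/-- Hash values are modelled as independent uniform random numbers in `[0, 1]`. -/
noncomputable def hashMeasure : Measure Source :=
  Measure.infinitePi fun _ => (volume : Measure unitInterval)

open Classical in
/-- The recursion of processing element `i` on the block `B`, in which `k` edges are to be sampled:
nothing is done unless `B` contains chunks of `i`; a single chunk is sampled sequentially; otherwise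
three hypergeometric variates split `k` among the four quadrants. The lists record the emitted edges,
which are paid for in `methodA` and `methodD`. -/
noncomputable def peBlock (n P i : ℕ) (ω : Source) (B : Block) (k : ℕ) : Timed (List (Sym2 ℕ)) :=
  if h : B.Meets i then
    if h' : B.IsChunk then do
      tick
      let xs ← methodD (fun r t j => (ω (B, r, t, j) : ℝ)) k (B.size n P) 0
      pure (xs.map (B.toEdge n P))
    else do
      tick
      let N := B.size n P
      let N₀ := (B.quad 0).size n P
      let N₁ := (B.quad 1).size n P
      let N₂ := (B.quad 2).size n P
      let k₀ ← hypSample (fun t j => (ω (B, 0, t, j) : ℝ)) N N₀ k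
      let k₁ ← hypSample (fun t j => (ω (B, 1, t, j) : ℝ)) (N - N₀) N₁ (k - k₀)
      let k₂ ← hypSample (fun t j => (ω (B, 2, t, j) : ℝ)) (N - N₀ - N₁) N₂ (k - k₀ - k₁)
      let e₀ ← peBlock n P i ω (B.quad 0) k₀
      let e₁ ← peBlock n P i ω (B.quad 1) k₁
      let e₂ ← peBlock n P i ω (B.quad 2) k₂
      let e₃ ← peBlock n P i ω (B.quad 3) (k - k₀ - k₁ - k₂)
      pure (e₀ ++ e₁ ++ e₂ ++ e₃)
  else pure []
termination_by B.weight
decreasing_by all_goals exact Block.weight_quad_lt h h' _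

/-- Output the `len` vertices `v, ..., v + len - 1`, one step each. -/
def outputVertices : (len v : ℕ) → Timed (List ℕ)
  | 0, _ => pure []
  | len + 1, v => do
      tick
      let rest ← outputVertices len (v + 1)
      pure (v :: rest)

/-- The program of processing element `i` of the undirected `G(n, m)` generator on `P` processing
elements: it outputs the vertices of its section and all edges in row `i` and column `i` of the
chunk matrix. -/
noncomputable def peRun (n m P i : ℕ) (ω : Source) : Timed (List ℕ × List (Sym2 ℕ)) := do
  let vs ← outputVertices (secStart n P (i + 1) - secStart n P i) (secStart n P i)
  let es ← peBlock n P i ω (Block.tri 0 P) m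
  pure (vs, es)

/-- Running time of the generator: the processing elements run in parallel and without
communication, so it is the maximum of their running times. -/
noncomputable def runningTime (n m P : ℕ) (ω : Source) : ℕ∞ :=
  ⨆ i : Fin P, (peRun n m P i ω).time

end ERGen

namespace ERGen

open ProbabilityTheory

/-! ### Expectations of functions of disjoint sets of hash values -/

/-! The proof bounds an exponential moment of the running time of a single processing element;
Markov's inequality and a union bound over the `P` elements finish it. Weighting `t` steps by `rate
^ t` turns sequential composition into a product, and computations that read disjoint sets of hash
values are independent, so bounds on their expected weights multiply (`MeanLE.mul`). `MeanLE` only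
asks for a measurable majorant, so measurability of the program itself is never at issue.

Acceptance-rejection: every trial has a box of hash values, of probability at least 1/80, on which
it is accepted, so the expected weight of a loop is at most 6480. For hypergeometric draws, time and
result have to be controlled jointly. One trial returns `z` with probability at most 6 times the
hypergeometric probability of `z`, so the weight restricted to result `z` has expectation at most
38880 times that probability (`meanLE_hypSample`). Up to a constant factor per draw, the sampler
thus behaves like an exact variate, and its exactness is not needed.

Recursion: sampling inside a chunk costs a factor of at most `edgeWeight` per edge
(`meanLE_methodD`). Hypergeometric splitting is Vandermonde convolution, so generating functions
multiply (`sum_hypPMF_mul_hypMoment_le`). Induction on blocks (`meanLE_peBlock`) gives `blockWeight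
^ visits` times the expectation of `edgeWeight ^ X`, where `X` counts those of `k` uniformly chosen
entries of the block that belong to the element. There are at most `6 * P` visits
(`Block.visits_quad_le`). The moment of `X` is at most `exp ((edgeWeight - 1) * E X)`
(`hypMoment_le_exp`), and `E X` is at most `4 * m / P + P` (`expected_edges_le`). -/

abbrev SeedIndex : Type := Block × ℕ × ℕ × ℕ

instance : IsProbabilityMeasure hashMeasure := by
  unfold hashMeasure; infer_instance

/-- The σ-algebra generated by the hash values with indices in `S`. -/
@[reducible]
def seedAlgebra (S : Set SeedIndex) : MeasurableSpace Source :=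
  ⨆ x ∈ S, MeasurableSpace.comap (fun ω : Source => ω x) inferInstance

theorem seedAlgebra_le (S : Set SeedIndex) : seedAlgebra S ≤ MeasurableSpace.pi :=
  iSup₂_le fun x _ => (measurable_pi_apply x).comap_le

theorem seedAlgebra_mono {S T : Set SeedIndex} (h : S ⊆ T) : seedAlgebra S ≤ seedAlgebra T :=
  biSup_mono h

theorem measurable_eval_seed {S : Set SeedIndex} {x : SeedIndex} (hx : x ∈ S) :
    Measurable[seedAlgebra S] (fun ω : Source => ω x) :=
  Measurable.of_comap_le
    (le_iSup₂_of_le (f := fun x (_ : x ∈ S) =>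
      MeasurableSpace.comap (fun ω : Source => ω x) inferInstance) x hx le_rfl)

theorem indep_seedAlgebra {S T : Set SeedIndex} (h : Disjoint S T) :
    Indep (seedAlgebra S) (seedAlgebra T) hashMeasure := by
  have h_ind : iIndepFun (fun (x : SeedIndex) (ω : Source) => ω x) hashMeasure :=
    iIndepFun_infinitePi (P := fun _ : SeedIndex => (volume : Measure unitInterval))
      (X := fun _ => id) (fun _ => measurable_id)
  exact indep_iSup_of_disjoint (fun x => (measurable_pi_apply x).comap_le) h_ind h

/-- Almost everywhere, `f` is at most a function of the hash values in `S` with expectation at most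
`c`. -/
def MeanLE (S : Set SeedIndex) (f : Source → ℝ≥0∞) (c : ℝ≥0∞) : Prop :=
  ∃ g : Source → ℝ≥0∞, Measurable[seedAlgebra S] g ∧ f ≤ᵐ[hashMeasure] g ∧
    ∫⁻ ω, g ω ∂hashMeasure ≤ c

theorem MeanLE.mono {S T : Set SeedIndex} {f f' : Source → ℝ≥0∞} {c c' : ℝ≥0∞}
    (h : MeanLE S f c) (hST : S ⊆ T) (hf : f' ≤ᵐ[hashMeasure] f) (hc : c ≤ c') :
    MeanLE T f' c' := by
  obtain ⟨g, hg, hfg, hgc⟩ := h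
  exact ⟨g, hg.mono (seedAlgebra_mono hST) le_rfl, hf.trans hfg, hgc.trans hc⟩

theorem MeanLE.of_le {S : Set SeedIndex} {f f' : Source → ℝ≥0∞} {c : ℝ≥0∞}
    (h : MeanLE S f c) (hf : ∀ ω, f' ω ≤ f ω) : MeanLE S f' c :=
  h.mono subset_rfl (Filter.Eventually.of_forall hf) le_rfl

theorem meanLE_const (S : Set SeedIndex) (c : ℝ≥0∞) : MeanLE S (fun _ => c) c :=
  ⟨fun _ => c, measurable_const, Filter.EventuallyLE.rfl, by simp⟩

theorem meanLE_top (S : Set SeedIndex) (f : Source → ℝ≥0∞) : MeanLE S f ⊤ :=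
  (meanLE_const S ⊤).of_le fun _ => le_top

/-- The majorants of the two factors are measurable for independent σ-algebras, so the integral of
their product factors. -/
theorem MeanLE.mul {S T : Set SeedIndex} {f f' : Source → ℝ≥0∞} {c c' : ℝ≥0∞}
    (h : MeanLE S f c) (h' : MeanLE T f' c') (hST : Disjoint S T) :
    MeanLE (S ∪ T) (fun ω => f ω * f' ω) (c * c') := by
  obtain ⟨g, hg, hfg, hgc⟩ := h
  obtain ⟨g', hg', hfg', hgc'⟩ := h'
  refine ⟨fun ω => g ω * g' ω, ?_, ?_, ?_⟩
  · have h1 := hg.mono (seedAlgebra_mono (Set.subset_union_left (t := T))) le_rfl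
    have h2 := hg'.mono (seedAlgebra_mono (Set.subset_union_right (s := S))) le_rfl
    exact h1.mul h2
  · filter_upwards [hfg, hfg'] with ω h1 h2 using mul_le_mul' h1 h2
  · rw [lintegral_mul_eq_lintegral_mul_lintegral_of_independent_measurableSpace
      (seedAlgebra_le S) (seedAlgebra_le T) (indep_seedAlgebra hST) hg hg']
    exact mul_le_mul' hgc hgc'

theorem MeanLE.const_mul {S : Set SeedIndex} {f : Source → ℝ≥0∞} {c : ℝ≥0∞}
    (h : MeanLE S f c) (a : ℝ≥0∞) : MeanLE S (fun ω => a * f ω) (a * c) := by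
  simpa using (meanLE_const ∅ a).mul h (Set.empty_disjoint S)

theorem measurable_tsum_fun {Ω ι : Type*} [Countable ι] {m : MeasurableSpace Ω}
    {g : ι → Ω → ℝ≥0∞} (hg : ∀ i, Measurable (g i)) : Measurable fun ω => ∑' i, g i ω :=
  Measurable.tsum hg

theorem MeanLE.tsum {ι : Type*} [Countable ι] {S : Set SeedIndex} {f : ι → Source → ℝ≥0∞}
    {c : ι → ℝ≥0∞} (h : ∀ i, MeanLE S (f i) (c i)) :
    MeanLE S (fun ω => ∑' i, f i ω) (∑' i, c i) := by
  choose g hg hfg hgc using h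
  refine ⟨fun ω => ∑' i, g i ω, ?_, ?_, ?_⟩
  · exact measurable_tsum_fun hg
  · filter_upwards [ae_all_iff.2 hfg] with ω hω using ENNReal.tsum_le_tsum hω
  · rw [lintegral_tsum fun i => ((hg i).mono (seedAlgebra_le S) le_rfl).aemeasurable]
    exact ENNReal.tsum_le_tsum hgc

theorem MeanLE.add {S : Set SeedIndex} {f f' : Source → ℝ≥0∞} {c c' : ℝ≥0∞}
    (h : MeanLE S f c) (h' : MeanLE S f' c') : MeanLE S (fun ω => f ω + f' ω) (c + c') := by
  have := MeanLE.tsum (ι := Bool) (S := S) (f := fun b => cond b f f') (c := fun b => cond b c c')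
    (by rintro (_ | _) <;> assumption)
  simpa [tsum_bool, add_comm] using this

theorem MeanLE.prod {ι : Type*} {S : ι → Set SeedIndex} {f : ι → Source → ℝ≥0∞} {c : ι → ℝ≥0∞}
    (h : ∀ i, MeanLE (S i) (f i) (c i)) (hS : Pairwise fun i j => Disjoint (S i) (S j))
    (s : Finset ι) : MeanLE (⋃ i ∈ s, S i) (fun ω => ∏ i ∈ s, f i ω) (∏ i ∈ s, c i) := by
  classical
  induction s using Finset.induction_on with
  | empty => simpa using meanLE_const ∅ 1
  | insert a s ha ih =>
    simp only [Finset.prod_insert ha]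
    refine ((h a).mul ih ?_).mono (by simp) Filter.EventuallyLE.rfl le_rfl
    simp only [Set.disjoint_iUnion_right]
    exact fun i hi => hS (by rintro rfl; exact ha hi)

/-! ### Probabilities of events given by one or three hash values -/

theorem measurable_indicator_one {Ω : Type*} {m : MeasurableSpace Ω} {s : Set Ω}
    (hs : MeasurableSet s) : Measurable (s.indicator (1 : Ω → ℝ≥0∞)) :=
  measurable_one.indicator hs

theorem volume_preimage_coe {A : Set ℝ} (hA : MeasurableSet A) :
    (volume : Measure unitInterval) ((↑) ⁻¹' A) = volume (A ∩ Set.Icc 0 1) := by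
  rw [Measure.Subtype.volume_def, Measure.comap_apply _ Subtype.val_injective
    (fun s hs => MeasurableSet.subtype_image measurableSet_Icc hs) _ (measurable_subtype_coe hA),
    Subtype.image_preimage_coe, Set.inter_comm]

/-- The event that the hash value with index `x` lies in `A`. -/
theorem meanLE_indicator_eval (x : SeedIndex) {A : Set ℝ} (hA : MeasurableSet A) :
    MeanLE {x} (Set.indicator {ω : Source | (ω x : ℝ) ∈ A} 1) (volume (A ∩ Set.Icc 0 1)) := by
  have hm : Measurable[seedAlgebra {x}] fun ω : Source => (ω x : ℝ) :=
    measurable_subtype_coe.comp (measurable_eval_seed rfl)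
  have hm' : MeasurableSet[seedAlgebra {x}] {ω : Source | (ω x : ℝ) ∈ A} := hm hA
  refine ⟨_, measurable_indicator_one hm',
    Filter.EventuallyLE.rfl, ?_⟩
  rw [lintegral_indicator_one (seedAlgebra_le _ _ hm')]
  have h1 : hashMeasure {ω : Source | (ω x : ℝ) ∈ A} =
      (volume : Measure unitInterval) ((↑) ⁻¹' A) := by
    have := Measure.infinitePi_map_eval (fun _ : SeedIndex => (volume : Measure unitInterval)) x
    rw [← this, Measure.map_apply (measurable_pi_apply x) (measurable_subtype_coe hA)]
    rfl
  rw [h1, volume_preimage_coe hA]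

/-- The complement of the event that the hash values with the distinct indices `x`, `y`, `z` lie in
given sets. -/
theorem meanLE_indicator_box_compl {x y z : SeedIndex} (hxy : x ≠ y) (hxz : x ≠ z) (hyz : y ≠ z)
    {A B C : Set ℝ} (hA : MeasurableSet A) (hB : MeasurableSet B) (hC : MeasurableSet C)
    {q : ℝ≥0∞} (hq : q ≤ volume (A ∩ Set.Icc 0 1) *
      (volume (B ∩ Set.Icc 0 1) * volume (C ∩ Set.Icc 0 1))) :
    MeanLE {x, y, z}
      (Set.indicator {ω : Source | (ω x : ℝ) ∈ A ∧ (ω y : ℝ) ∈ B ∧ (ω z : ℝ) ∈ C}ᶜ 1)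
      (1 - q) := by
  classical
  have hm : ∀ w ∈ ({x, y, z} : Set SeedIndex),
      Measurable[seedAlgebra {x, y, z}] fun ω : Source => (ω w : ℝ) := fun w hw =>
    measurable_subtype_coe.comp (measurable_eval_seed hw)
  have hE : MeasurableSet[seedAlgebra {x, y, z}]
      {ω : Source | (ω x : ℝ) ∈ A ∧ (ω y : ℝ) ∈ B ∧ (ω z : ℝ) ∈ C} :=
    MeasurableSet.inter (hm x (by simp) hA)
      (MeasurableSet.inter (hm y (by simp) hB) (hm z (by simp) hC))
  refine ⟨_, measurable_indicator_one hE.compl,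
    Filter.EventuallyLE.rfl, ?_⟩
  rw [lintegral_indicator_one (seedAlgebra_le _ _ hE.compl),
    prob_compl_eq_one_sub (seedAlgebra_le _ _ hE)]
  refine tsub_le_tsub_left (hq.trans_eq ?_) 1
  let t : SeedIndex → Set unitInterval := fun w =>
    if w = x then (↑) ⁻¹' A else if w = y then (↑) ⁻¹' B else (↑) ⁻¹' C
  have ht : ∀ w ∈ ({x, y, z} : Finset SeedIndex), MeasurableSet (t w) := by
    intro w _
    simp only [t]
    split_ifs
    exacts [measurable_subtype_coe hA, measurable_subtype_coe hB, measurable_subtype_coe hC]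
  have := Measure.infinitePi_pi (fun _ : SeedIndex => (volume : Measure unitInterval)) ht
  rw [Finset.prod_insert (by simp [hxy, hxz]), Finset.prod_insert (by simp [hyz]),
    Finset.prod_singleton] at this
  have e : {ω : Source | (ω x : ℝ) ∈ A ∧ (ω y : ℝ) ∈ B ∧ (ω z : ℝ) ∈ C} =
      Set.pi (({x, y, z} : Finset SeedIndex) : Set SeedIndex) t := by
    ext ω
    simp [t, Set.pi, hxy.symm, hxz.symm, hyz.symm]
  rw [e]
  refine Eq.trans ?_ this.symm
  simp [t, hxy.symm, hxz.symm, hyz.symm, volume_preimage_coe hA, volume_preimage_coe hB, volume_preimage_coe hC]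

/-! ### Exponential weights of running times -/

/-- Base of the exponential moments. -/
noncomputable def rate : ℝ≥0∞ := ENNReal.ofReal (81 / 80)

theorem one_le_rate : 1 ≤ rate := by
  rw [rate, ENNReal.one_le_ofReal]; norm_num

open Classical in
/-- `rate ^ t`, where `t` is a number of steps. -/
noncomputable def expTime (t : ℕ∞) : ℝ≥0∞ := if t = ⊤ then ⊤ else rate ^ t.toNat

@[simp] theorem expTime_top : expTime ⊤ = ⊤ := by simp [expTime]

@[simp] theorem expTime_natCast (t : ℕ) : expTime t = rate ^ t := by simp [expTime]

@[simp] theorem expTime_zero : expTime 0 = 1 := by simpa using expTime_natCast 0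

@[simp] theorem expTime_one : expTime 1 = rate := by simpa using expTime_natCast 1

theorem one_le_expTime (t : ℕ∞) : 1 ≤ expTime t := by
  induction t using ENat.recTopCoe with
  | top => simp
  | coe t => simpa using one_le_pow₀ one_le_rate

theorem expTime_add (s t : ℕ∞) : expTime (s + t) = expTime s * expTime t := by
  have h : ∀ t, expTime t ≠ 0 := fun t => (zero_lt_one.trans_le (one_le_expTime t)).ne'
  induction s using ENat.recTopCoe with
  | top => simp [ENNReal.top_mul (h t)]
  | coe s =>
    induction t using ENat.recTopCoe with
    | top => simp [ENNReal.mul_top (h s), -expTime_natCast]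
    | coe t => rw [← Nat.cast_add]; simp only [expTime_natCast, pow_add]

theorem expTime_mono {s t : ℕ∞} (h : s ≤ t) : expTime s ≤ expTime t := by
  obtain ⟨u, rfl⟩ := exists_add_of_le h
  rw [expTime_add]
  exact le_mul_of_one_le_right' (one_le_expTime u)

open Classical in
/-- The weight of a computation that has a given result. -/
noncomputable def Timed.weightAt (x : Timed ℕ) (z : ℕ) : ℝ≥0∞ :=
  if x.val = z then expTime x.time else 0

theorem Timed.time_bind {α β : Type} (x : Timed α) (f : α → Timed β) :
    (x >>= f).time = x.time + (f x.val).time := rfl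

theorem Timed.time_pure {α : Type} (a : α) : (pure a : Timed α).time = 0 := rfl

theorem time_tick : tick.time = 1 := rfl

/-- Only the term of the actual result is nonzero. The sum form serves to feed the continuation a
fixed `z` instead of a random one, which makes it independent of the draw. -/
theorem Timed.expTime_bind {β : Type} (x : Timed ℕ) (f : ℕ → Timed β) :
    expTime (x >>= f).time = ∑' z, x.weightAt z * expTime (f z).time := by
  rw [tsum_eq_single x.val]
  · simp [weightAt, Timed.time_bind, expTime_add]
  · intro z hz
    simp [weightAt, hz.symm]

/-! ### Acceptance-rejection loops -/

/-- The expected weight of the number of trials, if a trial succeeds with probability `1 / 80`. -/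
theorem tsum_rate_mul_pow :
    ∑' t : ℕ, rate ^ (t + 1) * (1 - ENNReal.ofReal (1 / 80)) ^ t = 6480 := by
  have h1 : (1 : ℝ≥0∞) - ENNReal.ofReal (1 / 80) = ENNReal.ofReal (79 / 80) := by
    rw [← ENNReal.ofReal_one, ← ENNReal.ofReal_sub _ (by norm_num)]; norm_num
  -- The series converges because 81/80 · 79/80 = 6399/6400; its sum is 81/80 · 6400 = 6480.
  have h2 : ∀ t : ℕ, rate ^ (t + 1) * (1 - ENNReal.ofReal (1 / 80)) ^ t =
      rate * ENNReal.ofReal (6399 / 6400) ^ t := by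
    intro t
    rw [h1, rate, pow_succ', mul_assoc, ← mul_pow, ← ENNReal.ofReal_mul (by norm_num)]
    norm_num
  simp_rw [h2]
  rw [ENNReal.tsum_mul_left, ENNReal.tsum_geometric, rate, ← ENNReal.ofReal_one,
    ← ENNReal.ofReal_sub _ (by norm_num), ← ENNReal.ofReal_inv_of_pos (by norm_num),
    ← ENNReal.ofReal_mul (by norm_num)]
  norm_num

/-- Indicator of the event that none of the trials before trial `t` is in its box. -/
noncomputable def noneBefore (E : ℕ → Set Source) (t : ℕ) (ω : Source) : ℝ≥0∞ :=
  ∏ s ∈ Finset.range t, Set.indicator (E s)ᶜ 1 ω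

theorem noneBefore_eq_one {E : ℕ → Set Source} {t : ℕ} {ω : Source} (h : ∀ s < t, ω ∉ E s) :
    noneBefore E t ω = 1 :=
  Finset.prod_eq_one fun s hs => by simp [h s (Finset.mem_range.1 hs)]

theorem meanLE_noneBefore {E : ℕ → Set Source} {S : ℕ → Set SeedIndex} {q : ℝ≥0∞}
    (h : ∀ t, MeanLE (S t) (Set.indicator (E t)ᶜ 1) q)
    (hS : Pairwise fun i j => Disjoint (S i) (S j)) (t : ℕ) :
    MeanLE (⋃ s ∈ Finset.range t, S s) (noneBefore E t) (q ^ t) := by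
  have := MeanLE.prod h hS (Finset.range t)
  rwa [Finset.prod_const, Finset.card_range] at this

theorem retry_spec {trial : ℕ → Option ℕ} (h : ∃ t, (trial t).isSome) :
    ∃ t, (retry trial).time = (t + 1 : ℕ) ∧ trial t = some (retry trial).val ∧
      ∀ s < t, trial s = none := by
  classical
  refine ⟨Nat.find h, ?_, ?_, fun s hs => ?_⟩
  · rw [retry, dif_pos h]
  · rw [retry, dif_pos h]; simp
  · simpa using Nat.find_min h hs

/-- All trials before the accepted one miss their boxes, so a single term already dominates. If no
trial is ever accepted, all indicators are one and the series diverges. -/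
theorem expTime_retry_le {trial : ℕ → Option ℕ} {E : ℕ → Set Source} {ω : Source}
    (hacc : ∀ t, ω ∈ E t → (trial t).isSome) :
    expTime (retry trial).time ≤ ∑' t, rate ^ (t + 1) * noneBefore E t ω := by
  by_cases h : ∃ t, (trial t).isSome
  · obtain ⟨t, ht, -, hn⟩ := retry_spec h
    refine le_trans ?_ (ENNReal.le_tsum t)
    rw [ht, expTime_natCast, noneBefore_eq_one, mul_one]
    intro s hs hω
    simpa [hn s hs] using hacc s hω
  · have : ∀ t, noneBefore E t ω = 1 := fun t =>
      noneBefore_eq_one fun s _ hω => h ⟨s, hacc s hω⟩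
    simp_rw [this, mul_one]
    refine le_top.trans_eq (Eq.symm ?_)
    refine top_unique ?_
    rw [← ENNReal.tsum_const_eq_top_of_ne_zero (α := ℕ) one_ne_zero]
    exact ENNReal.tsum_le_tsum fun t => one_le_pow₀ one_le_rate

theorem meanLE_tsum_noneBefore {E : ℕ → Set Source} {S : ℕ → Set SeedIndex}
    (h : ∀ t, MeanLE (S t) (Set.indicator (E t)ᶜ 1) (1 - ENNReal.ofReal (1 / 80)))
    (hS : Pairwise fun i j => Disjoint (S i) (S j)) :
    MeanLE (⋃ t, S t) (fun ω => ∑' t, rate ^ (t + 1) * noneBefore E t ω) 6480 := by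
  rw [← tsum_rate_mul_pow]
  exact MeanLE.tsum fun t => ((meanLE_noneBefore h hS t).const_mul _).mono
    (Set.iUnion₂_subset fun s _ => Set.subset_iUnion S s) Filter.EventuallyLE.rfl le_rfl

/-- Sum over the index of the accepted trial: missing the earlier boxes and obtaining `z` now are
events on disjoint hash values. -/
theorem meanLE_weightAt_retry {trial : ℕ → Source → Option ℕ} {E : ℕ → Set Source}
    {S : ℕ → Set SeedIndex} (hacc : ∀ t, ∀ ω ∈ E t, (trial t ω).isSome)
    (h : ∀ t, MeanLE (S t) (Set.indicator (E t)ᶜ 1) (1 - ENNReal.ofReal (1 / 80)))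
    (hS : Pairwise fun i j => Disjoint (S i) (S j)) {z : ℕ} {c : ℝ≥0∞}
    (hz : ∀ t, MeanLE (S t) (Set.indicator {ω | trial t ω = some z} 1) c) :
    MeanLE (⋃ t, S t) (fun ω => (retry fun t => trial t ω).weightAt z) (6480 * c) := by
  -- A loop without accepted trial has the default result 0 and infinite weight, so this null event
  -- must be discarded.
  have hfin : ∀ᵐ ω ∂hashMeasure, ∃ t, (trial t ω).isSome := by
    obtain ⟨g, hg, hle, hint⟩ := meanLE_tsum_noneBefore h hS
    have := ae_lt_top (hg.mono (seedAlgebra_le _) le_rfl)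
      (ne_top_of_le_ne_top (by norm_num) hint)
    filter_upwards [this, hle] with ω h1 h2
    by_contra hcon
    have h3 := (expTime_retry_le (trial := fun t => trial t ω) fun t => hacc t ω).trans h2
    rw [retry, dif_neg hcon, expTime_top, top_le_iff] at h3
    exact h1.ne h3
  have key : MeanLE (⋃ t, S t) (fun ω => ∑' t, rate ^ (t + 1) * (noneBefore E t ω *
      Set.indicator {ω | trial t ω = some z} 1 ω)) (6480 * c) := by
    rw [← tsum_rate_mul_pow, ← ENNReal.tsum_mul_right]
    refine MeanLE.tsum fun t => ?_
    rw [mul_assoc]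
    refine (((meanLE_noneBefore h hS t).mul (hz t) ?_).const_mul _).mono
      (Set.union_subset (Set.iUnion₂_subset fun s _ => Set.subset_iUnion S s)
        (Set.subset_iUnion S t)) Filter.EventuallyLE.rfl le_rfl
    simp only [Set.disjoint_iUnion_left]
    exact fun s hs => hS (Finset.mem_range.1 hs).ne
  refine key.mono subset_rfl ?_ le_rfl
  filter_upwards [hfin] with ω hω
  obtain ⟨t, ht, hval, hn⟩ := retry_spec (trial := fun t => trial t ω) hω
  unfold Timed.weightAt
  split_ifs with hz
  · refine le_trans ?_ (ENNReal.le_tsum t)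
    rw [hz] at hval
    rw [ht, expTime_natCast, noneBefore_eq_one, Set.indicator_of_mem (by exact hval)]
    · simp
    · intro s hs hω
      simpa [hn s hs] using hacc s ω hω
  · exact zero_le

/-! ### The hypergeometric distribution -/

theorem hypPMF_nonneg (N K k : ℕ) (z : ℤ) : 0 ≤ hypPMF N K k z := by
  unfold hypPMF; split_ifs <;> positivity

theorem hypPMF_of_neg {N K k : ℕ} {z : ℤ} (h : z < 0) : hypPMF N K k z = 0 :=
  if_neg (by omega)

theorem hypPMF_natCast_of_le {N K k z : ℕ} (h : z ≤ k) :
    hypPMF N K k z = (K.choose z : ℝ) * ((N - K).choose (k - z) : ℝ) / (N.choose k : ℝ) := by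
  rw [hypPMF, if_pos (by omega)]; simp

theorem hypPMF_natCast_of_lt {N K k z : ℕ} (h : k < z) : hypPMF N K k z = 0 :=
  if_neg (by omega)

theorem hypPMF_eq_zero_of_lt {N K k z : ℕ} (h : K < z) : hypPMF N K k z = 0 := by
  rcases le_or_gt z k with hz | hz
  · simp [hypPMF_natCast_of_le hz, Nat.choose_eq_zero_of_lt h]
  · exact hypPMF_natCast_of_lt hz

theorem hypPMF_eq_zero_of_lt_sub {N K k z : ℕ} (h : N - K < k - z) : hypPMF N K k z = 0 := by
  simp [hypPMF_natCast_of_le (show z ≤ k by omega), Nat.choose_eq_zero_of_lt h]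

theorem hypPMF_pos {N K k z : ℕ} (hk : k ≤ N) (h1 : z ≤ k) (h2 : z ≤ K) (h3 : k - z ≤ N - K) :
    0 < hypPMF N K k z := by
  rw [hypPMF_natCast_of_le h1]
  have := Nat.choose_pos h2
  have := Nat.choose_pos h3
  have := Nat.choose_pos hk
  positivity

theorem sum_hypPMF {N K k : ℕ} (hK : K ≤ N) (hk : k ≤ N) :
    ∑ z ∈ Finset.range (k + 1), hypPMF N K k (z : ℕ) = 1 := by
  have h1 : ∀ z ∈ Finset.range (k + 1), hypPMF N K k (z : ℕ) =
      ((K.choose z * (N - K).choose (k - z) : ℕ) : ℝ) / (N.choose k : ℝ) := by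
    intro z hz
    rw [hypPMF_natCast_of_le (by simpa [Nat.lt_succ_iff] using hz)]
    push_cast; rfl
  have h2 := Nat.add_choose_eq K (N - K) k
  rw [Finset.Nat.sum_antidiagonal_eq_sum_range_succ fun i j => K.choose i * (N - K).choose j,
    Nat.add_sub_cancel' hK] at h2
  rw [Finset.sum_congr rfl h1, ← Finset.sum_div, ← Nat.cast_sum, ← h2, div_self]
  exact_mod_cast (Nat.choose_pos hk).ne'

theorem cast_choose_succ_mul (n k : ℕ) :
    (n.choose (k + 1) : ℝ) * (k + 1) = n.choose k * ((n : ℝ) - k) := by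
  rcases le_or_gt k n with h | h
  · have := Nat.choose_succ_right_eq n k
    rw [← Nat.cast_sub h]
    exact_mod_cast this
  · simp [Nat.choose_eq_zero_of_lt h, Nat.choose_eq_zero_of_lt (h.trans (Nat.lt_succ_self k))]

/-- The ratio of consecutive probabilities, cleared of denominators so that no support condition is
needed. -/
theorem hypPMF_succ_mul {N K k : ℕ} (hK : K ≤ N) (z : ℕ) :
    hypPMF N K k (z + 1 : ℕ) * (((z : ℝ) + 1) * ((N : ℝ) - K - k + z + 1)) =
      hypPMF N K k z * (((K : ℝ) - z) * ((k : ℝ) - z)) := by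
  rcases lt_trichotomy z k with h | rfl | h
  · obtain ⟨j, rfl⟩ : ∃ j, k = z + 1 + j := ⟨k - (z + 1), by omega⟩
    have h1 := cast_choose_succ_mul K z
    have h2 := cast_choose_succ_mul (N - K) j
    rw [Nat.cast_sub hK] at h2
    rw [hypPMF_natCast_of_le (by omega), hypPMF_natCast_of_le (by omega),
      show z + 1 + j - (z + 1) = j by omega, show z + 1 + j - z = j + 1 by omega]
    push_cast
    rw [div_mul_eq_mul_div, div_mul_eq_mul_div]
    congr 1
    linear_combination (((N - K).choose j : ℝ) * ((N : ℝ) - K - j)) * h1 -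
      ((K.choose z : ℝ) * ((K : ℝ) - z)) * h2
  · rw [hypPMF_natCast_of_lt (Nat.lt_succ_self _)]; ring
  · rw [hypPMF_natCast_of_lt h, hypPMF_natCast_of_lt (by omega)]; ring

/-- If the ratios of consecutive terms decrease from at most one, and term `j` is less than half of
term zero, then all terms together are at most `2 * j` times term zero. -/
theorem sum_range_le_of_antitone_ratio {g ρ : ℕ → ℝ} (hg : ∀ t, g (t + 1) = ρ t * g t)
    (hρ : Antitone ρ) (hρ0 : ∀ t, 0 ≤ ρ t) (hρ1 : ρ 0 ≤ 1) (hp : 0 < g 0) {j : ℕ}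
    (hj : g j < g 0 / 2) (n : ℕ) : ∑ i ∈ Finset.range n, g i ≤ 2 * j * g 0 := by
  have hnn : ∀ t, 0 ≤ g t := fun t => by
    induction t with
    | zero => exact hp.le
    | succ t ih => rw [hg]; exact mul_nonneg (hρ0 t) ih
  have hle : ∀ t, g t ≤ g 0 := fun t => by
    induction t with
    | zero => exact le_rfl
    | succ t ih =>
      rw [hg]
      exact (mul_le_of_le_one_left (hnn t) ((hρ t.zero_le).trans hρ1)).trans ih
  -- Log-concavity: the decay over `j` steps is weakest when it starts at term zero.
  have hmul : ∀ i, g (j + i) * g 0 ≤ g i * g j := fun i => by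
    induction i with
    | zero => simp [mul_comm]
    | succ i ih =>
      rw [← add_assoc, hg, hg i]
      calc ρ (j + i) * g (j + i) * g 0 = ρ (j + i) * (g (j + i) * g 0) := by ring
        _ ≤ ρ (j + i) * (g i * g j) := mul_le_mul_of_nonneg_left ih (hρ0 _)
        _ ≤ ρ i * (g i * g j) :=
          mul_le_mul_of_nonneg_right (hρ (by omega)) (mul_nonneg (hnn _) (hnn _))
        _ = ρ i * g i * g j := by ring
  have hhalf : ∀ i, g (j + i) ≤ g i / 2 := fun i => by
    have h1 := hmul i
    have h2 : g i * g j ≤ g i * (g 0 / 2) := mul_le_mul_of_nonneg_left hj.le (hnn i)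
    refine le_of_mul_le_mul_right (h1.trans (h2.trans_eq ?_)) hp
    ring
  -- The first `j` terms contribute at most `j * g 0`, the shifted ones at most half of the sum
  -- being bounded.
  have h1 : ∑ i ∈ Finset.range n, g i ≤ ∑ i ∈ Finset.range (j + n), g i :=
    Finset.sum_le_sum_of_subset_of_nonneg (Finset.range_mono (by omega)) fun i _ _ => hnn i
  rw [Finset.sum_range_add] at h1
  have h2 : ∑ i ∈ Finset.range j, g i ≤ j * g 0 := by
    simpa using Finset.sum_le_card_nsmul (Finset.range j) g (g 0) fun i _ => hle i
  have h3 : ∑ i ∈ Finset.range n, g (j + i) ≤ (∑ i ∈ Finset.range n, g i) / 2 := by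
    rw [Finset.sum_div]
    exact Finset.sum_le_sum fun i _ => hhalf i
  linarith

/-- The mode of the hypergeometric distribution. -/
abbrev hypMode (N K k : ℕ) : ℕ := (K + 1) * (k + 1) / (N + 2)

/-! ### The mode and the decay of the probabilities on both sides of it -/

section Mode

variable {N K k : ℕ}

theorem hypMode_mul_le (N K k : ℕ) : hypMode N K k * (N + 2) ≤ (K + 1) * (k + 1) :=
  Nat.div_mul_le_self _ _

theorem lt_hypMode_mul (N K k : ℕ) : (K + 1) * (k + 1) < (hypMode N K k + 1) * (N + 2) :=
  (Nat.lt_mul_div_succ ((K + 1) * (k + 1)) (show 0 < N + 2 by omega)).trans_eq (mul_comm _ _)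

theorem hypMode_le_left (hk : k ≤ N) : hypMode N K k ≤ K := by
  have h : (K + 1) * (k + 1) < (K + 1) * (N + 2) := Nat.mul_lt_mul_of_pos_left (by omega) (by omega)
  have := Nat.div_lt_of_lt_mul (h.trans_eq (mul_comm _ _))
  exact Nat.lt_succ_iff.1 this

theorem hypMode_le_right (hK : K ≤ N) : hypMode N K k ≤ k := by
  have h : (K + 1) * (k + 1) < (N + 2) * (k + 1) :=
    Nat.mul_lt_mul_of_pos_right (by omega) (by omega)
  exact Nat.lt_succ_iff.1 (Nat.div_lt_of_lt_mul h)

theorem add_le_hypMode_add (hK : K ≤ N) (hk : k ≤ N) : K + k ≤ hypMode N K k + N := by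
  by_contra hcon
  push Not at hcon
  obtain ⟨z, hz⟩ : ∃ z, K + k = N + 1 + z := ⟨K + k - (N + 1), by omega⟩
  have h1 : (hypMode N K k + 1) * (N + 2) ≤ (z + 1) * (N + 2) :=
    Nat.mul_le_mul_right _ (by omega)
  have h2 := (lt_hypMode_mul N K k).trans_le h1
  obtain ⟨a, rfl⟩ := Nat.exists_eq_add_of_le hK
  obtain ⟨b, hb⟩ := Nat.exists_eq_add_of_le hk
  obtain ⟨d, rfl⟩ : ∃ d, k = a + 1 + d := ⟨k - (a + 1), by omega⟩
  obtain rfl : z = d := by omega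
  -- The two sides of `h2` differ by `(a + 1) * (K - d)`, which is nonnegative because `k ≤ N`.
  nlinarith

theorem hypPMF_mode_pos (hK : K ≤ N) (hk : k ≤ N) : 0 < hypPMF N K k (hypMode N K k : ℕ) :=
  hypPMF_pos hk (hypMode_le_right hK) (hypMode_le_left hk)
    (by have := add_le_hypMode_add hK hk; omega)

theorem hypPMF_mode_le_one (hK : K ≤ N) (hk : k ≤ N) :
    hypPMF N K k (hypMode N K k : ℕ) ≤ 1 := by
  rw [← sum_hypPMF hK hk]
  exact Finset.single_le_sum (f := fun z : ℕ => hypPMF N K k z)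
    (fun z _ => hypPMF_nonneg N K k z)
    (Finset.mem_range.2 (Nat.lt_succ_iff.2 (hypMode_le_right hK)))

theorem antitone_max_sub (a : ℝ) : Antitone fun i : ℕ => max (a - i) 0 := fun _ _ h =>
  max_le_max (sub_le_sub_left (Nat.cast_le.2 h) a) le_rfl

/-- Truncating the factors at zero keeps the ratios nonnegative and decreasing beyond the end of the
support. -/
theorem antitone_ratio {a b c d : ℝ} (hc : 0 < c) (hd : 0 < d) :
    Antitone fun i : ℕ => max (a - i) 0 * max (b - i) 0 / ((c + i) * (d + i)) := by
  intro i j h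
  have hij : (i : ℝ) ≤ j := Nat.cast_le.2 h
  have h1 := antitone_max_sub a h
  have h2 := antitone_max_sub b h
  simp only at h1 h2 ⊢
  gcongr

theorem sum_hypPMF_mode_add_le (hK : K ≤ N) (hk : k ≤ N) {j : ℕ}
    (hj : hypPMF N K k (hypMode N K k + j : ℕ) < hypPMF N K k (hypMode N K k : ℕ) / 2) (n : ℕ) :
    ∑ i ∈ Finset.range n, hypPMF N K k (hypMode N K k + i : ℕ) ≤
      2 * j * hypPMF N K k (hypMode N K k : ℕ) := by
  set M := hypMode N K k with hM
  have hMN : (K : ℝ) + k ≤ M + N := by exact_mod_cast add_le_hypMode_add hK hk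
  have hMK : (M : ℝ) ≤ K := by exact_mod_cast hypMode_le_left (K := K) hk
  have hMk : (M : ℝ) ≤ k := by exact_mod_cast hypMode_le_right (k := k) hK
  have hlt : ((K : ℝ) + 1) * (k + 1) < (M + 1) * (N + 2) := by
    exact_mod_cast lt_hypMode_mul N K k
  have hc : (0 : ℝ) < M + 1 := by positivity
  have hd : (0 : ℝ) < (N : ℝ) - K - k + M + 1 := by linarith
  refine sum_range_le_of_antitone_ratio (g := fun i => hypPMF N K k (M + i : ℕ))
    (fun i => ?_) (antitone_ratio (a := (K : ℝ) - M) (b := (k : ℝ) - M) hc hd)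
    (fun t => by positivity) ?_ (hypPMF_mode_pos hK hk) hj n
  · have h := hypPMF_succ_mul (k := k) hK (M + i)
    push_cast at h
    have hpos : (0 : ℝ) < (M + 1 + i) * ((N : ℝ) - K - k + M + 1 + i) := by positivity
    rw [div_mul_eq_mul_div, eq_div_iff hpos.ne']
    rcases lt_or_ge K (M + i) with h1 | h1
    · rw [← add_assoc, hypPMF_eq_zero_of_lt h1, hypPMF_eq_zero_of_lt (h1.trans (Nat.lt_succ_self _))]
      ring
    rcases lt_or_ge k (M + i) with h2 | h2
    · rw [← add_assoc, hypPMF_natCast_of_lt h2, hypPMF_natCast_of_lt (h2.trans (Nat.lt_succ_self _))]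
      ring
    have h1' : (M : ℝ) + i ≤ K := by exact_mod_cast h1
    have h2' : (M : ℝ) + i ≤ k := by exact_mod_cast h2
    rw [max_eq_left (by linarith), max_eq_left (by linarith)]
    rw [← add_assoc]
    push_cast
    linear_combination h
  · rw [div_le_one (by positivity)]
    simp only [Nat.cast_zero, sub_zero, add_zero]
    rw [max_eq_left (by linarith), max_eq_left (by linarith)]
    -- Expanded, "ratio at most one" reads `(K + 1) * (k + 1) ≤ (M + 1) * (N + 2)`, which is the
    -- upper half of the definition of the mode.
    nlinarith

/-- Mirror image of `sum_hypPMF_mode_add_le`; integer arguments let the walk continue below zero,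
where the probability vanishes. -/
theorem sum_hypPMF_mode_sub_le (hK : K ≤ N) (hk : k ≤ N) {j : ℕ}
    (hj : hypPMF N K k ((hypMode N K k : ℤ) - j) < hypPMF N K k (hypMode N K k : ℕ) / 2) (n : ℕ) :
    ∑ i ∈ Finset.range n, hypPMF N K k ((hypMode N K k : ℤ) - (i : ℕ)) ≤
      2 * j * hypPMF N K k (hypMode N K k : ℕ) := by
  set M := hypMode N K k with hM
  have hMN : (K : ℝ) + k ≤ M + N := by exact_mod_cast add_le_hypMode_add hK hk
  have hMK : (M : ℝ) ≤ K := by exact_mod_cast hypMode_le_left (K := K) hk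
  have hMk : (M : ℝ) ≤ k := by exact_mod_cast hypMode_le_right (k := k) hK
  have hle : (M : ℝ) * (N + 2) ≤ (K + 1) * (k + 1) := by
    exact_mod_cast hypMode_mul_le N K k
  have hc : (0 : ℝ) < K - M + 1 := by linarith
  have hd : (0 : ℝ) < k - M + 1 := by linarith
  have key := sum_range_le_of_antitone_ratio (j := j) (g := fun i : ℕ => hypPMF N K k ((M : ℤ) - (i : ℕ)))
    (fun i => ?_) (antitone_ratio (a := (M : ℝ)) (b := (N : ℝ) - K - k + M) hc hd)
    (fun t => by positivity) ?_ ?_ ?_ n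
  · simpa only [Nat.cast_zero, sub_zero] using key
  · have hpos : (0 : ℝ) < (K - M + 1 + i) * ((k : ℝ) - M + 1 + i) := by positivity
    rw [div_mul_eq_mul_div, eq_div_iff hpos.ne']
    rcases le_or_gt M i with h1 | h1
    · have h1' : (M : ℝ) ≤ i := by exact_mod_cast h1
      rw [hypPMF_of_neg (by push_cast; omega), max_eq_right (by linarith)]
      ring
    obtain ⟨z, hz⟩ : ∃ z, M = z + 1 + i := ⟨M - 1 - i, by omega⟩
    have h := hypPMF_succ_mul (k := k) hK z
    have hzr : (M : ℝ) = z + 1 + i := by exact_mod_cast hz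
    rw [show (M : ℤ) - ((i + 1 : ℕ) : ℤ) = (z : ℕ) by push_cast; omega,
      show (M : ℤ) - ((i : ℕ) : ℤ) = (z + 1 : ℕ) by push_cast; omega]
    rcases lt_or_ge (N - K) (k - (z + 1)) with h2 | h2
    · rw [hypPMF_eq_zero_of_lt_sub h2, hypPMF_eq_zero_of_lt_sub (show N - K < k - z by omega)]
      ring
    have h2' : k + K ≤ N + (z + 1) := by omega
    have h3 : (k : ℝ) + K ≤ N + (z + 1) := by exact_mod_cast h2'
    rw [max_eq_left (by linarith), max_eq_left (by linarith), hzr]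
    linear_combination -h
  · rw [div_le_one (by positivity)]
    simp only [Nat.cast_zero, sub_zero, add_zero]
    rw [max_eq_left (by linarith), max_eq_left (by linarith)]
    -- Expanded, this is `M * (N + 2) ≤ (K + 1) * (k + 1)`.
    nlinarith
  · simpa only [Nat.cast_zero, sub_zero] using hypPMF_mode_pos hK hk
  · simpa only [Nat.cast_zero, sub_zero] using hj

/-- On one side of the mode, the probabilities stay large for at least `1 / (4 * p)` steps, where `p`
is the probability of the mode. -/
theorem hypPMF_mode_half_le (hK : K ≤ N) (hk : k ≤ N) :
    (∀ i : ℕ, i * (4 * hypPMF N K k (hypMode N K k : ℕ)) < 1 →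
      hypPMF N K k (hypMode N K k : ℕ) / 2 ≤ hypPMF N K k ((hypMode N K k : ℤ) + i)) ∨
    (∀ i : ℕ, i * (4 * hypPMF N K k (hypMode N K k : ℕ)) < 1 →
      hypPMF N K k (hypMode N K k : ℕ) / 2 ≤ hypPMF N K k ((hypMode N K k : ℤ) - i)) := by
  -- If both sides dropped below `p / 2` within `1 / (4 * p)` steps, each would have total less than
  -- 1/2, contradicting total mass one. Counting the mode twice does no harm.
  by_contra! hcon
  obtain ⟨⟨i, hi, hgi⟩, ⟨j, hj, hgj⟩⟩ := hcon
  set M := hypMode N K k with hM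
  have hMk : M ≤ k := hypMode_le_right hK
  have h1 := sum_hypPMF_mode_add_le hK hk (j := i) (by push_cast; exact hgi) (k + 1 - M)
  have h2 := sum_hypPMF_mode_sub_le hK hk hgj (M + 1)
  have h3 : ∑ i ∈ Finset.range (M + 1), hypPMF N K k ((M : ℤ) - (i : ℕ)) =
      ∑ i ∈ Finset.range (M + 1), hypPMF N K k (i : ℕ) := by
    rw [← Finset.sum_range_reflect (fun i : ℕ => hypPMF N K k (i : ℕ)) (M + 1)]
    refine Finset.sum_congr rfl fun i hi => ?_
    have := Finset.mem_range.1 hi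
    congr 1
    omega
  have h4 := sum_hypPMF hK hk
  rw [show k + 1 = M + (k + 1 - M) by omega, Finset.sum_range_add] at h4
  rw [← hM] at h1 h2
  rw [h3, Finset.sum_range_succ] at h2
  have h5 := hypPMF_nonneg N K k M
  linarith

end Mode

/-! ### Trials for hypergeometric variates -/

theorem volume_Iio_inter_Icc {c : ℝ} (h : c ≤ 1) :
    volume (Set.Iio c ∩ Set.Icc 0 1) = ENNReal.ofReal c := by
  rw [show Set.Iio c ∩ Set.Icc 0 1 = Set.Ico 0 c from Set.ext fun x =>
    ⟨fun hx => ⟨hx.2.1, hx.1⟩, fun hx => ⟨hx.2, hx.1, hx.2.le.trans h⟩⟩]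
  simp

open Classical in
/-- The values of the number that selects a sign for which trials are likely to be accepted. -/
noncomputable def goodSide (N K k : ℕ) : Set ℝ :=
  if ∀ i : ℕ, i * (4 * hypPMF N K k (hypMode N K k : ℕ)) < 1 →
      hypPMF N K k (hypMode N K k : ℕ) / 2 ≤ hypPMF N K k ((hypMode N K k : ℤ) + i)
  then Set.Iio (1 / 2) else Set.Ici (1 / 2)

theorem measurableSet_goodSide (N K k : ℕ) : MeasurableSet (goodSide N K k) := by
  unfold goodSide; split_ifs
  exacts [measurableSet_Iio, measurableSet_Ici]

theorem volume_goodSide (N K k : ℕ) :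
    volume (goodSide N K k ∩ Set.Icc 0 1) = ENNReal.ofReal (1 / 2) := by
  unfold goodSide; split_ifs
  · exact volume_Iio_inter_Icc (by norm_num)
  · rw [Set.inter_comm, show Set.Icc (0 : ℝ) 1 ∩ Set.Ici (1 / 2) = Set.Icc (1 / 2) 1 from
      Set.ext fun x => ⟨fun hx => ⟨hx.2, hx.1.2⟩, fun hx =>
        ⟨⟨(by norm_num : (0 : ℝ) ≤ 1 / 2).trans hx.1, hx.2⟩, hx.1⟩⟩, Real.volume_Icc]
    norm_num

/-- A small `u` puts `y` in the flat part of the hat, so near the mode that on the good side the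
probability is still at least `p / 2`, while the hat is at most `p`. -/
theorem hypTrial_isSome {N K k : ℕ} (hK : K ≤ N) (hk : k ≤ N) {u v s w : ℝ} (hu0 : 0 ≤ u)
    (hw0 : 0 ≤ w) (hu : u < 1 / 20) (hs : s ∈ goodSide N K k) (hw : w < 1 / 2) :
    (hypTrial N K k u v s w).isSome := by
  have hp := hypPMF_mode_pos hK hk
  have hp1 := hypPMF_mode_le_one hK hk
  have hside := hypPMF_mode_half_le hK hk
  unfold hypTrial
  unfold goodSide at hs
  simp only
  unfold hypMode at *
  set M : ℕ := (K + 1) * (k + 1) / (N + 2) with hM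
  set p : ℝ := hypPMF N K k M
  -- As `p ≤ 1`, the factor is at most 5/2, and 5/2 · 1/20 = 1/8.
  have ha : u * (1 + (1 + p / 2)) < 1 / 8 := by nlinarith
  have ha0 : 0 ≤ u * (1 + (1 + p / 2)) := by positivity
  rw [if_pos (show u * (1 + (1 + p / 2)) ≤ 1 + p / 2 by linarith)]
  set y : ℝ := u * (1 + (1 + p / 2)) / p with hy
  have hy0 : 0 ≤ y := by positivity
  have hyp : y * p < 1 / 8 := by rwa [hy, div_mul_cancel₀ _ hp.ne']
  obtain ⟨i, hi⟩ : ∃ i : ℕ, ⌊y + 1 / 2⌋ = (i : ℤ) :=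
    ⟨⌊y + 1 / 2⌋.toNat, (Int.toNat_of_nonneg (Int.floor_nonneg.2 (by positivity))).symm⟩
  have hi' : (i : ℝ) ≤ y + 1 / 2 := by
    have := Int.floor_le (y + 1 / 2)
    rw [hi] at this
    exact_mod_cast this
  have hip : i * (4 * p) < 1 := by
    rcases Nat.eq_zero_or_pos i with h0 | h0
    · simp [h0]
    -- A nonzero `i` forces `y ≥ 1 / 2`, hence `i ≤ 2 * y` and `4 * p * i ≤ 8 * p * y < 1`.
    · have h1 : (1 : ℝ) ≤ i := by exact_mod_cast h0
      nlinarith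
  rw [hi]
  have hz : p / 2 ≤ hypPMF N K k (if s < 1 / 2 then (M : ℤ) + i else (M : ℤ) - i) := by
    split_ifs at hs with h
    · rw [if_pos (show s < 1 / 2 from hs)]; exact h i hip
    · rw [if_neg (not_lt.2 (show 1 / 2 ≤ s from hs))]; exact hside.resolve_left h i hip
  rw [if_pos]
  · rfl
  · refine lt_of_lt_of_le ?_ hz
    calc w * min p (p * Real.exp (1 + p / 2 - p * y)) ≤ w * p :=
          mul_le_mul_of_nonneg_left (min_le_left _ _) hw0
      _ < p / 2 := by nlinarith

/-- The set of numbers `v` that lead to the result `i` in the exponential tail of the hat. -/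
def tailBox (p : ℝ) (i : ℤ) : Set ℝ :=
  Set.Ioc (Real.exp (1 + p / 2 - (i + 1 / 2) * p)) (Real.exp (1 + p / 2 - (i + 1 / 2) * p + p)) ∪ {0}

/-- The set of numbers `u` that lead to the result `i` in the flat part of the hat. -/
def flatBox (p : ℝ) (i : ℤ) : Set ℝ :=
  Set.Ico ((i - 1 / 2) * p / (2 + p / 2)) ((i - 1 / 2) * p / (2 + p / 2) + p / (2 + p / 2))

/-- The result fixes the rounded offset up to sign, which confines `u` or `v` to an interval and `w`
below a threshold. The case `w < 0` is split off since there a negative integer could be accepted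
and truncated to 0. -/
theorem hypTrial_eq_some {N K k : ℕ} (hK : K ≤ N) (hk : k ≤ N) {u v s w : ℝ}
    (hv : 0 ≤ v) (hv1 : v ≤ 1) {z : ℕ} (h : hypTrial N K k u v s w = some z) :
    ∃ i : ℤ, (i = z - hypMode N K k ∨ i = hypMode N K k - z) ∧
      ((u ∈ flatBox (hypPMF N K k (hypMode N K k : ℕ)) i ∧
        w ∈ Set.Iio (hypPMF N K k z / hypPMF N K k (hypMode N K k : ℕ))) ∨
      (v ∈ tailBox (hypPMF N K k (hypMode N K k : ℕ)) i ∧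
        w ∈ Set.Iio (hypPMF N K k z / hypPMF N K k (hypMode N K k : ℕ) *
          Real.exp (-(1 + hypPMF N K k (hypMode N K k : ℕ) / 2 -
            (i + 1 / 2) * hypPMF N K k (hypMode N K k : ℕ)))))) ∨ w < 0 := by
  have hp := hypPMF_mode_pos hK hk
  unfold hypTrial at h
  simp only at h
  unfold hypMode at *
  set M : ℕ := (K + 1) * (k + 1) / (N + 2) with hM
  set p : ℝ := hypPMF N K k M
  set y : ℝ := if u * (1 + (1 + p / 2)) ≤ 1 + p / 2 then u * (1 + (1 + p / 2)) / p else
    (1 + p / 2 - Real.log v) / p with hy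
  set z' : ℤ := if s < 1 / 2 then (M : ℤ) + ⌊y + 1 / 2⌋ else (M : ℤ) - ⌊y + 1 / 2⌋ with hz'
  rcases lt_or_ge w 0 with hw0 | hw0
  · exact ⟨z - M, Or.inr hw0⟩
  split_ifs at h with hacc
  have hz0 : 0 ≤ z' := by
    by_contra hneg
    rw [hypPMF_of_neg (not_le.1 hneg)] at hacc
    have : 0 ≤ w * min p (p * Real.exp (1 + p / 2 - p * y)) := by positivity
    linarith
  have hzz : z' = z := by
    rw [← Option.some.inj h, Int.toNat_of_nonneg hz0]
  rw [hzz] at hacc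
  refine ⟨⌊y + 1 / 2⌋, Or.inl ⟨?_, ?_⟩⟩
  · rw [hzz] at hz'
    split_ifs at hz' <;> omega
  have hf1 := Int.floor_le (y + 1 / 2)
  have hf2 := Int.lt_floor_add_one (y + 1 / 2)
  set i : ℤ := ⌊y + 1 / 2⌋
  by_cases ha : u * (1 + (1 + p / 2)) ≤ 1 + p / 2
  · left
    rw [if_pos ha] at hy
    have hyp : p * y = u * (1 + (1 + p / 2)) := by rw [hy]; field_simp
    have hb : (0 : ℝ) < 2 + p / 2 := by positivity
    refine ⟨⟨?_, ?_⟩, ?_⟩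
    · rw [div_le_iff₀ hb]; nlinarith
    · rw [← add_div, lt_div_iff₀ hb]; nlinarith
    · rw [Set.mem_Iio, lt_div_iff₀ hp]
      rwa [min_eq_left] at hacc
      refine le_mul_of_one_le_right hp.le (Real.one_le_exp ?_)
      rw [hyp]; linarith
  · right
    rw [if_neg ha] at hy
    have hyp : p * y = 1 + p / 2 - Real.log v := by rw [hy]; field_simp
    -- For `v = 0` the convention `log 0 = 0` applies; this is why `tailBox` contains the point 0.
    have hlog : Real.log v ≤ 0 := Real.log_nonpos hv hv1
    have hl1 : 1 + p / 2 - (i + 1 / 2) * p < Real.log v := by nlinarith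
    have hl2 : Real.log v ≤ 1 + p / 2 - (i + 1 / 2) * p + p := by nlinarith
    refine ⟨?_, ?_⟩
    · rcases hv.eq_or_lt with h0 | h0
      · right; exact h0.symm
      · left
        rw [← Real.exp_log h0]
        exact ⟨Real.exp_lt_exp.2 hl1, Real.exp_le_exp.2 hl2⟩
    · rw [hyp, sub_sub_cancel, min_eq_right
        (mul_le_of_le_one_right hp.le (Real.exp_le_one_iff.2 hlog))] at hacc
      rw [Set.mem_Iio, div_mul_eq_mul_div, lt_div_iff₀ hp]
      have h1 : w * p < hypPMF N K k z * Real.exp (-Real.log v) := by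
        rw [Real.exp_neg, ← div_eq_mul_inv, lt_div_iff₀ (Real.exp_pos _)]
        linarith
      refine h1.trans_le (mul_le_mul_of_nonneg_left (Real.exp_le_exp.2 ?_) (hypPMF_nonneg _ _ _ _))
      linarith

theorem volume_Iio_inter_Icc_le (c : ℝ) :
    volume (Set.Iio c ∩ Set.Icc 0 1) ≤ ENNReal.ofReal c := by
  calc volume (Set.Iio c ∩ Set.Icc 0 1) ≤ volume (Set.Ico 0 c) :=
        measure_mono fun x hx => ⟨hx.2.1, hx.1⟩
    _ = ENNReal.ofReal c := by simp

theorem volume_flatBox_mul_le {p q : ℝ} (hp : 0 < p) (hq : 0 ≤ q) (i : ℤ) :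
    volume (flatBox p i ∩ Set.Icc 0 1) * volume (Set.Iio (q / p) ∩ Set.Icc 0 1) ≤
      ENNReal.ofReal q := by
  refine (mul_le_mul' (measure_mono Set.inter_subset_left) (volume_Iio_inter_Icc_le _)).trans ?_
  rw [flatBox, Real.volume_Ico, add_sub_cancel_left, ← ENNReal.ofReal_mul (by positivity)]
  refine ENNReal.ofReal_le_ofReal ?_
  rw [div_mul_div_comm, mul_comm p q, mul_div_mul_right _ _ hp.ne']
  exact div_le_self hq (by linarith)

/-- The interval has length `exp β * (exp p - 1) ≤ 2 * p * exp β`, and the acceptance threshold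
carries `exp (-β)`, so the exponentials cancel. -/
theorem volume_tailBox_mul_le {p q : ℝ} (hp : 0 < p) (hp1 : p ≤ 1) (hq : 0 ≤ q) (i : ℤ) :
    volume (tailBox p i ∩ Set.Icc 0 1) *
      volume (Set.Iio (q / p * Real.exp (-(1 + p / 2 - (i + 1 / 2) * p))) ∩ Set.Icc 0 1) ≤
      ENNReal.ofReal (2 * q) := by
  refine (mul_le_mul' ((measure_mono Set.inter_subset_left).trans (measure_union_le _ _))
    (volume_Iio_inter_Icc_le _)).trans ?_
  set β : ℝ := 1 + p / 2 - (i + 1 / 2) * p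
  have hexp : Real.exp p - 1 ≤ 2 * p := by
    have := abs_le.1 (Real.abs_exp_sub_one_sub_id_le (x := p) (by rwa [abs_of_pos hp]))
    nlinarith [this.2]
  have h1 : 0 ≤ Real.exp p - 1 := by linarith [Real.add_one_le_exp p]
  have e : Real.exp (β + p) - Real.exp β = Real.exp β * (Real.exp p - 1) := by
    rw [Real.exp_add]; ring
  rw [Real.volume_Ioc, Real.volume_singleton, add_zero, e, ← ENNReal.ofReal_mul (by positivity)]
  refine ENNReal.ofReal_le_ofReal ?_
  calc Real.exp β * (Real.exp p - 1) * (q / p * Real.exp (-β))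
      = (Real.exp β * Real.exp (-β)) * ((Real.exp p - 1) * q / p) := by ring
    _ = (Real.exp p - 1) * q / p := by rw [← Real.exp_add]; simp
    _ ≤ 2 * p * q / p := by gcongr
    _ = 2 * q := by field_simp

/-! ### The hash values used by a trial -/

/-- The hash values that supply trial `t` of draw `r` for the block `B`. -/
def trialSeeds (B : Block) (r t : ℕ) : Set SeedIndex := Set.range fun j => (B, r, t, j)

/-- The hash values that supply draw `r` for the block `B`. -/
def drawSeeds (B : Block) (r : ℕ) : Set SeedIndex := ⋃ t, trialSeeds B r t

theorem mem_trialSeeds {B : Block} {r t : ℕ} {x : SeedIndex} :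
    x ∈ trialSeeds B r t ↔ x.1 = B ∧ x.2.1 = r ∧ x.2.2.1 = t := by
  obtain ⟨B', r', t', j'⟩ := x
  simp [trialSeeds, eq_comm]

theorem mem_drawSeeds {B : Block} {r : ℕ} {x : SeedIndex} :
    x ∈ drawSeeds B r ↔ x.1 = B ∧ x.2.1 = r := by
  simp [drawSeeds, mem_trialSeeds]

theorem pairwise_disjoint_trialSeeds (B : Block) (r : ℕ) :
    Pairwise fun s t => Disjoint (trialSeeds B r s) (trialSeeds B r t) := fun _ _ h =>
  Set.disjoint_left.2 fun _ hx hy =>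
    h ((mem_trialSeeds.1 hx).2.2.symm.trans (mem_trialSeeds.1 hy).2.2)

theorem disjoint_drawSeeds (B : Block) {r r' : ℕ} (h : r ≠ r') :
    Disjoint (drawSeeds B r) (drawSeeds B r') :=
  Set.disjoint_left.2 fun _ hx hy =>
    h ((mem_drawSeeds.1 hx).2.symm.trans (mem_drawSeeds.1 hy).2)

/-- The factor 6 is two signs of the offset times 1 (flat part) plus 2 (tail). -/
theorem meanLE_hypTrial (B : Block) (r t : ℕ) {N K k : ℕ} (hK : K ≤ N) (hk : k ≤ N) (z : ℕ) :
    MeanLE (trialSeeds B r t)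
      (Set.indicator {ω : Source | hypTrial N K k (ω (B, r, t, 0)) (ω (B, r, t, 1))
        (ω (B, r, t, 2)) (ω (B, r, t, 3)) = some z} 1)
      (6 * ENNReal.ofReal (hypPMF N K k z)) := by
  have hp := hypPMF_mode_pos hK hk
  have hp1 := hypPMF_mode_le_one hK hk
  have hq := hypPMF_nonneg N K k z
  set M := hypMode N K k
  set p := hypPMF N K k M
  set q := hypPMF N K k z
  have hpair : ∀ (j : ℕ), j ≠ 3 → ∀ A C : Set ℝ, MeasurableSet A → MeasurableSet C →
      MeanLE (trialSeeds B r t) (fun ω => Set.indicator {ω : Source | (ω (B, r, t, j) : ℝ) ∈ A} 1 ω *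
        Set.indicator {ω : Source | (ω (B, r, t, 3) : ℝ) ∈ C} 1 ω)
        (volume (A ∩ Set.Icc 0 1) * volume (C ∩ Set.Icc 0 1)) := by
    intro j hj A C hA hC
    refine ((meanLE_indicator_eval (B, r, t, j) hA).mul (meanLE_indicator_eval (B, r, t, 3) hC)
      (by simpa using hj)).mono ?_ Filter.EventuallyLE.rfl le_rfl
    intro x hx
    rcases hx with rfl | rfl <;> simp [mem_trialSeeds]
  have hflat : ∀ i : ℤ, _ := fun i => (hpair 0 (by norm_num) (flatBox p i) (Set.Iio (q / p))
    measurableSet_Ico measurableSet_Iio).mono subset_rfl Filter.EventuallyLE.rfl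
      (volume_flatBox_mul_le hp hq i)
  have htail : ∀ i : ℤ, _ := fun i => (hpair 1 (by norm_num) (tailBox p i)
    (Set.Iio (q / p * Real.exp (-(1 + p / 2 - (i + 1 / 2) * p))))
    (measurableSet_Ioc.union (measurableSet_singleton 0)) measurableSet_Iio).mono subset_rfl
      Filter.EventuallyLE.rfl (volume_tailBox_mul_le hp hp1 hq i)
  have hsum := ((hflat (z - M)).add (htail (z - M))).add ((hflat (M - z)).add (htail (M - z)))
  refine hsum.mono subset_rfl (Filter.Eventually.of_forall fun ω => ?_) (le_of_eq ?_)
  · by_cases h : ω ∈ {ω : Source | hypTrial N K k (ω (B, r, t, 0)) (ω (B, r, t, 1))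
        (ω (B, r, t, 2)) (ω (B, r, t, 3)) = some z}
    · rw [Set.indicator_of_mem h, Pi.one_apply]
      obtain ⟨i, ⟨hi, hbox⟩ | hw⟩ := hypTrial_eq_some hK hk (ω (B, r, t, 1)).2.1
        (ω (B, r, t, 1)).2.2 h
      · have hone : ∀ i : ℤ, (((ω (B, r, t, 0) : ℝ) ∈ flatBox p i ∧
            (ω (B, r, t, 3) : ℝ) ∈ Set.Iio (q / p)) ∨ ((ω (B, r, t, 1) : ℝ) ∈ tailBox p i ∧
            (ω (B, r, t, 3) : ℝ) ∈
              Set.Iio (q / p * Real.exp (-(1 + p / 2 - (i + 1 / 2) * p))))) →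
            (1 : ℝ≥0∞) ≤
              Set.indicator {ω : Source | (ω (B, r, t, 0) : ℝ) ∈ flatBox p i} 1 ω *
              Set.indicator {ω : Source | (ω (B, r, t, 3) : ℝ) ∈ Set.Iio (q / p)} 1 ω +
              Set.indicator {ω : Source | (ω (B, r, t, 1) : ℝ) ∈ tailBox p i} 1 ω *
              Set.indicator {ω : Source | (ω (B, r, t, 3) : ℝ) ∈
                Set.Iio (q / p * Real.exp (-(1 + p / 2 - (i + 1 / 2) * p)))} 1 ω := by
          rintro i (⟨h1, h2⟩ | ⟨h1, h2⟩)
          · refine le_add_right ?_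
            rw [Set.indicator_of_mem (by exact h1), Set.indicator_of_mem (by exact h2)]; simp
          · refine le_add_left ?_
            rw [Set.indicator_of_mem (by exact h1), Set.indicator_of_mem (by exact h2)]; simp
        rcases hi with rfl | rfl
        · exact le_add_right (hone _ hbox)
        · exact le_add_left (hone _ hbox)
      · exact absurd (ω (B, r, t, 3)).2.1 (not_le.2 hw)
    · rw [Set.indicator_of_notMem h]; exact zero_le
  · rw [ENNReal.ofReal_mul (by norm_num), ENNReal.ofReal_ofNat]
    ring

/-- Trial `t` is in its box: it is accepted whatever its last number is. -/
def hypBox (B : Block) (r N K k t : ℕ) : Set Source :=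
  {ω | (ω (B, r, t, 0) : ℝ) ∈ Set.Iio (1 / 20) ∧ (ω (B, r, t, 2) : ℝ) ∈ goodSide N K k ∧
    (ω (B, r, t, 3) : ℝ) ∈ Set.Iio (1 / 2)}

/-- The box has probability 1/20 · 1/2 · 1/2 = 1/80. -/
theorem meanLE_hypBox_compl (B : Block) (r N K k t : ℕ) :
    MeanLE (trialSeeds B r t) (Set.indicator (hypBox B r N K k t)ᶜ 1)
      (1 - ENNReal.ofReal (1 / 80)) := by
  refine (meanLE_indicator_box_compl (x := (B, r, t, 0)) (y := (B, r, t, 2)) (z := (B, r, t, 3))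
    (by simp) (by simp) (by simp) measurableSet_Iio (measurableSet_goodSide N K k)
    measurableSet_Iio ?_).mono ?_ Filter.EventuallyLE.rfl le_rfl
  · rw [volume_goodSide, volume_Iio_inter_Icc (by norm_num), volume_Iio_inter_Icc (by norm_num),
      ← ENNReal.ofReal_mul (by norm_num), ← ENNReal.ofReal_mul (by norm_num)]
    norm_num
  · rintro x (rfl | rfl | rfl) <;> simp [mem_trialSeeds]

theorem meanLE_hypSample (B : Block) (r : ℕ) {N K k : ℕ} (hK : K ≤ N) (hk : k ≤ N) (z : ℕ) :
    MeanLE (drawSeeds B r)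
      (fun ω => (hypSample (fun t j => (ω (B, r, t, j) : ℝ)) N K k).weightAt z)
      (38880 * ENNReal.ofReal (hypPMF N K k z)) := by
  have := meanLE_weightAt_retry (E := hypBox B r N K k) (S := trialSeeds B r)
    (trial := fun t ω => hypTrial N K k (ω (B, r, t, 0)) (ω (B, r, t, 1)) (ω (B, r, t, 2))
      (ω (B, r, t, 3)))
    (fun t ω hω => hypTrial_isSome hK hk (ω (B, r, t, 0)).2.1 (ω (B, r, t, 3)).2.1 hω.1 hω.2.1
      hω.2.2)
    (meanLE_hypBox_compl B r N K k) (pairwise_disjoint_trialSeeds B r)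
    (fun t => meanLE_hypTrial B r t hK hk z)
  rw [← mul_assoc, show (6480 * 6 : ℝ≥0∞) = 38880 by norm_num] at this
  exact this

/-! ### Sequential sampling -/

theorem time_methodA_le (V : ℕ → ℝ) (N k pos : ℕ) (q : ℝ) :
    (methodA V N k pos q).time ≤ N := by
  induction N generalizing k pos q with
  | zero => simp [methodA, Timed.time_pure]
  | succ N ih =>
    cases k with
    | zero => simp [methodA, Timed.time_pure]
    | succ k =>
      rw [methodA, Timed.time_bind, time_tick, add_comm]
      refine (add_le_add_left ?_ 1).trans_eq (Nat.cast_succ N).symm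
      simp only
      split_ifs
      · exact ih _ _ _
      · rw [Timed.time_bind, Timed.time_pure, add_zero]
        exact ih _ _ _

/-! ### Acceptance probability and total cost of Method D -/

/-- A union bound: a uniform `k`-subset meets `s` given elements with probability at most `s * k /
n`. -/
theorem choose_sub_mul_le (n k s : ℕ) (hs : s ≤ n) (hk : k ≤ n) :
    (n.choose k : ℝ) * (n - s * k) ≤ n * ((n - s).choose k : ℝ) := by
  cases k with
  | zero => simp
  | succ k =>
    have h1 : (n : ℝ) * ((n - 1).choose k : ℝ) = n.choose (k + 1) * (k + 1) := by
      obtain ⟨n, rfl⟩ : ∃ n', n = n' + 1 := ⟨n - 1, by omega⟩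
      exact_mod_cast Nat.add_one_mul_choose_eq n k
    have h2 : ∀ s ≤ n, (n.choose (k + 1) : ℝ) ≤ (n - s).choose (k + 1) + s * (n - 1).choose k := by
      intro s
      induction s with
      | zero => simp
      | succ s ih =>
        intro hs
        obtain ⟨d, hd⟩ : ∃ d, n - s = d + 1 := ⟨n - s - 1, by omega⟩
        have h3 := ih (by omega)
        rw [hd, Nat.choose_succ_succ] at h3
        have h4 : d.choose k ≤ (n - 1).choose k := Nat.choose_le_choose k (by omega)
        have h5 : (d.choose k : ℝ) ≤ (n - 1).choose k := by exact_mod_cast h4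
        rw [show n - (s + 1) = d by omega]
        push_cast at h3 ⊢
        linarith
    have h3 := mul_le_mul_of_nonneg_left (h2 s hs) (Nat.cast_nonneg (α := ℝ) n)
    push_cast
    linear_combination h3 + (s : ℝ) * h1

/-- For `v ≥ 1 / 2` the skip satisfies `s * k ≤ 7 / 10 * N`, so its probability is at least 3/10 of
`k / N`. Sparsity bounds the hat by 13/12 of `k / N`, and 1/10 · 13/12 < 3/10. -/
theorem skipTrial_isSome {N k : ℕ} (hk : 1 ≤ k) (hN : 13 * k < N) {v u : ℝ} (hv : 1 / 2 ≤ v)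
    (hv1 : v ≤ 1) (hu : u < 1 / 10) : (skipTrial N k v u).isSome := by
  have hk' : (1 : ℝ) ≤ k := by exact_mod_cast hk
  have hN' : 13 * (k : ℝ) < N := by exact_mod_cast hN
  have hN0 : (0 : ℝ) < N := by linarith
  have hv0 : 0 < v := by linarith
  unfold skipTrial
  simp only
  set r : ℝ := v ^ ((1 : ℝ) / k) with hr
  have hr0 : 0 ≤ r := Real.rpow_nonneg hv0.le _
  have hr1 : r ≤ 1 := Real.rpow_le_one hv0.le hv1 (by positivity)
  -- From `1 + x ≤ exp x`, the left side is at most `-log v ≤ log 2 < 7 / 10`.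
  have hrk : (1 - r) * k ≤ 7 / 10 := by
    have h1 : Real.log v * (1 / k) + 1 ≤ r := by
      rw [hr, Real.rpow_def_of_pos hv0]; exact Real.add_one_le_exp _
    have h2 : -Real.log 2 ≤ Real.log v := by
      rw [← Real.log_inv]
      exact Real.log_le_log (by norm_num) (by linarith)
    have h3 := Real.log_two_lt_d9
    have h4 : (1 - r) * k ≤ -Real.log v := by
      have h5 : (1 - r) * k ≤ -(Real.log v * (1 / k)) * k :=
        mul_le_mul_of_nonneg_right (by linarith) (by linarith)
      have h6 : Real.log v * (1 / k) * k = Real.log v := by field_simp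
      linarith
    linarith
  set x : ℝ := N * (1 - r) with hx
  have hx0 : 0 ≤ x := mul_nonneg hN0.le (by linarith)
  have hxN : 1 - x / N = r := by rw [hx]; field_simp; ring
  have hs := Nat.floor_le hx0
  set s : ℕ := ⌊x⌋₊
  have hsk : s * k ≤ 7 / 10 * (N : ℝ) := by
    calc (s : ℝ) * k ≤ N * (1 - r) * k := mul_le_mul_of_nonneg_right hs (by linarith)
      _ = N * ((1 - r) * k) := by ring
      _ ≤ N * (7 / 10) := mul_le_mul_of_nonneg_left hrk hN0.le
      _ = _ := by ring
  have hsN : (s : ℝ) ≤ 7 / 10 * N := by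
    refine le_trans ?_ hsk
    exact le_mul_of_one_le_right (Nat.cast_nonneg _) hk'
  have hskN : s + k ≤ N := by
    have : (s : ℝ) + k ≤ N := by linarith
    exact_mod_cast this
  rw [if_pos]
  · rfl
  refine ⟨hskN, ?_⟩
  rw [hxN]
  obtain ⟨n, rfl⟩ : ∃ n, N = n + 1 := ⟨N - 1, by omega⟩
  obtain ⟨j, rfl⟩ : ∃ j, k = j + 1 := ⟨k - 1, by omega⟩
  rw [show n + 1 - s - 1 = n - s by omega, show j + 1 - 1 = j by omega]
  have h1 := choose_sub_mul_le n j s (by omega) (by omega)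
  have h2 : ((n : ℝ) + 1) * n.choose j = (n + 1).choose (j + 1) * (j + 1) := by
    exact_mod_cast Nat.add_one_mul_choose_eq n j
  have hC : (0 : ℝ) < (n + 1).choose (j + 1) := by exact_mod_cast Nat.choose_pos (by omega)
  have hc : (0 : ℝ) < n.choose j := by exact_mod_cast Nat.choose_pos (by omega)
  push_cast at *
  have hn : (0 : ℝ) < n := by linarith
  have h3 : (s : ℝ) * j ≤ 7 / 10 * n := by
    have h4 : (s : ℝ) * (j + 1) * n ≤ 7 / 10 * (n + 1) * n := mul_le_mul_of_nonneg_right hsk hn.le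
    have h5 : (0 : ℝ) ≤ s * (n - j) := mul_nonneg (Nat.cast_nonneg _) (by linarith)
    have h6 : (s : ℝ) * j * (n + 1) ≤ 7 / 10 * n * (n + 1) := by nlinarith
    exact le_of_mul_le_mul_right h6 hN0
  have h7 : 3 / 10 * (n.choose j : ℝ) ≤ (n - s).choose j := by
    refine le_of_mul_le_mul_left (le_trans ?_ h1) hn
    nlinarith
  have h8 : ((n : ℝ) + 1) / (n + 1 - (j + 1) + 1) ≤ 13 / 12 := by
    rw [div_le_iff₀ (by linarith)]
    linarith
  have h9 : r ^ j ≤ 1 := pow_le_one₀ hr0 hr1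
  have h10 : ((j : ℝ) + 1) / (n + 1) = n.choose j / (n + 1).choose (j + 1) := by
    rw [div_eq_div_iff hN0.ne' hC.ne']
    linarith
  rw [h10]
  have h11 : (0 : ℝ) < n.choose j / (n + 1).choose (j + 1) := div_pos hc hC
  calc u * (((n : ℝ) + 1) / (n + 1 - (j + 1) + 1) *
        ((n.choose j : ℝ) / (n + 1).choose (j + 1) * r ^ j))
      ≤ 1 / 10 * (13 / 12 * ((n.choose j : ℝ) / (n + 1).choose (j + 1) * 1)) := by
        have : (0 : ℝ) ≤ (n : ℝ) + 1 - (j + 1) + 1 := by linarith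
        gcongr
    _ < 3 / 10 * (n.choose j : ℝ) / (n + 1).choose (j + 1) := by
        rw [mul_div_assoc]; linarith
    _ ≤ _ := div_le_div_of_nonneg_right h7 hC.le

/-- Trial `t` of draw `r` is in its box: the skip is accepted. -/
def skipBox (B : Block) (r t : ℕ) : Set Source :=
  {ω | (ω (B, r, t, 0) : ℝ) ∈ Set.Ici (1 / 2) ∧ (ω (B, r, t, 1) : ℝ) ∈ Set.Iio (1 / 10) ∧
    (ω (B, r, t, 2) : ℝ) ∈ Set.univ}

theorem volume_Ici_inter_Icc {c : ℝ} (h : 0 ≤ c) :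
    volume (Set.Ici c ∩ Set.Icc 0 1) = ENNReal.ofReal (1 - c) := by
  rw [show Set.Ici c ∩ Set.Icc 0 1 = Set.Icc c 1 from Set.ext fun x =>
    ⟨fun hx => ⟨hx.1, hx.2.2⟩, fun hx => ⟨hx.1, h.trans hx.1, hx.2⟩⟩, Real.volume_Icc]

/-- The box has probability 1/2 · 1/10, more than the common bound 1/80; its third coordinate is a
dummy. -/
theorem meanLE_skipBox_compl (B : Block) (r t : ℕ) :
    MeanLE (trialSeeds B r t) (Set.indicator (skipBox B r t)ᶜ 1)
      (1 - ENNReal.ofReal (1 / 80)) := by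
  refine (meanLE_indicator_box_compl (x := (B, r, t, 0)) (y := (B, r, t, 1)) (z := (B, r, t, 2))
    (by simp) (by simp) (by simp) measurableSet_Ici measurableSet_Iio
    MeasurableSet.univ ?_).mono ?_ Filter.EventuallyLE.rfl le_rfl
  · rw [volume_Ici_inter_Icc (by norm_num), volume_Iio_inter_Icc (by norm_num), Set.univ_inter,
      Real.volume_Icc, ← ENNReal.ofReal_mul (by norm_num), ← ENNReal.ofReal_mul (by norm_num)]
    exact ENNReal.ofReal_le_ofReal (by norm_num)
  · rintro x (rfl | rfl | rfl) <;> simp [mem_trialSeeds]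

/-- Bound for the weight of the search for a skip in Method D. -/
noncomputable def skipWeight (B : Block) (r : ℕ) (ω : Source) : ℝ≥0∞ :=
  ∑' t, rate ^ (t + 1) * noneBefore (skipBox B r) t ω

theorem meanLE_skipWeight (B : Block) (r : ℕ) : MeanLE (drawSeeds B r) (skipWeight B r) 6480 :=
  meanLE_tsum_noneBefore (meanLE_skipBox_compl B r) (pairwise_disjoint_trialSeeds B r)

theorem one_le_skipWeight (B : Block) (r : ℕ) (ω : Source) : 1 ≤ skipWeight B r ω := by
  refine le_trans ?_ (ENNReal.le_tsum 0)
  simpa [noneBefore] using one_le_rate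

/-- Method A starts with at most 13 records per missing edge, so its deterministic cost is charged
to `rate ^ 14`; the skip weights of the draws left unused are at least one. -/
theorem expTime_methodD_le (B : Block) (ω : Source) (k N pos : ℕ) :
    expTime (methodD (fun r t j => (ω (B, r, t, j) : ℝ)) k N pos).time ≤
      ∏ r ∈ Finset.range k, rate ^ 14 * skipWeight B (r + 1) ω := by
  induction k generalizing N pos with
  | zero => simp [methodD, Timed.time_pure]
  | succ k ih =>
    rw [methodD]
    split_ifs with h
    · refine (expTime_mono ((time_methodA_le _ _ _ _ _).trans (Nat.cast_le.2 h))).trans ?_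
      rw [expTime_natCast, pow_mul, ← Finset.card_range (k + 1), ← Finset.prod_const, Finset.card_range]
      refine Finset.prod_le_prod' fun r _ => ?_
      exact (pow_le_pow_right₀ one_le_rate (by norm_num)).trans
        (le_mul_of_one_le_right' (one_le_skipWeight B (r + 1) ω))
    · rw [Finset.prod_range_succ, mul_comm]
      rw [Timed.time_bind, expTime_add, Timed.time_bind, expTime_add, time_tick, expTime_one,
        Timed.time_bind, Timed.time_pure, add_zero]
      have h1 : expTime (retry fun t => skipTrial N (k + 1) (ω (B, k + 1, t, 0))
          (ω (B, k + 1, t, 1))).time ≤ skipWeight B (k + 1) ω :=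
        expTime_retry_le fun t ht => skipTrial_isSome (by omega) (by omega) ht.1
          (ω (B, k + 1, t, 0)).2.2 ht.2.1
      rw [← mul_assoc]
      refine mul_le_mul' ?_ (ih _ _)
      rw [mul_comm]
      exact mul_le_mul' (le_self_pow₀ one_le_rate (by norm_num)) h1

theorem meanLE_methodD (B : Block) (k N pos : ℕ) :
    MeanLE (⋃ r, drawSeeds B r)
      (fun ω => expTime (methodD (fun r t j => (ω (B, r, t, j) : ℝ)) k N pos).time)
      ((rate ^ 14 * 6480) ^ k) := by
  have h := MeanLE.prod (fun r => (meanLE_skipWeight B (r + 1)).const_mul (rate ^ 14))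
    (fun r s hrs => disjoint_drawSeeds B (by simpa using hrs)) (Finset.range k)
  rw [Finset.prod_const, Finset.card_range] at h
  exact h.mono (Set.iUnion₂_subset fun r _ => Set.subset_iUnion (drawSeeds B) (r + 1))
    (Filter.Eventually.of_forall fun ω => expTime_methodD_le B ω k N pos) le_rfl

/-! ### Exponential moments of the hypergeometric distribution -/

section Moments

open Polynomial

/-- Coefficient `k` of this polynomial, divided by `N.choose k`, is the expectation of `L ^ X`, where
`X` is the number of elements of a uniform `k`-subset of an `N`-set in a given `s`-subset. -/
noncomputable def hypPoly (L : ℝ) (N s : ℕ) : ℝ[X] := (1 + C L * X) ^ s * (1 + X) ^ (N - s)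

/-- The expectation of `L ^ X`, where `X` is the number of elements of a uniform `k`-subset of an
`N`-set in a given `s`-subset. -/
noncomputable def hypMoment (L : ℝ) (N s k : ℕ) : ℝ := (hypPoly L N s).coeff k / N.choose k

theorem coeff_one_add_C_mul_X_pow (L : ℝ) (N k : ℕ) :
    ((1 + C L * X) ^ N : ℝ[X]).coeff k = N.choose k * L ^ k := by
  have : ((1 + C L * X) ^ N : ℝ[X]) = ((1 + X) ^ N : ℝ[X]).comp (C L * X) := by simp
  rw [this, comp_C_mul_X_coeff, coeff_one_add_X_pow]

theorem coeff_hypPoly_nonneg {L : ℝ} (hL : 0 ≤ L) (N s k : ℕ) : 0 ≤ (hypPoly L N s).coeff k := by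
  rw [hypPoly, coeff_mul]
  refine Finset.sum_nonneg fun x _ => ?_
  rw [coeff_one_add_C_mul_X_pow, coeff_one_add_X_pow]
  positivity

theorem hypMoment_nonneg {L : ℝ} (hL : 0 ≤ L) (N s k : ℕ) : 0 ≤ hypMoment L N s k :=
  div_nonneg (coeff_hypPoly_nonneg hL N s k) (Nat.cast_nonneg _)

theorem hypMoment_zero (L : ℝ) {N k : ℕ} (hk : k ≤ N) : hypMoment L N 0 k = 1 := by
  have : (N.choose k : ℝ) ≠ 0 := by exact_mod_cast (Nat.choose_pos hk).ne'
  rw [hypMoment, hypPoly, pow_zero, one_mul, Nat.sub_zero, coeff_one_add_X_pow, div_self this]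

theorem hypMoment_self (L : ℝ) {N k : ℕ} (hk : k ≤ N) : hypMoment L N N k = L ^ k := by
  have : (N.choose k : ℝ) ≠ 0 := by exact_mod_cast (Nat.choose_pos hk).ne'
  rw [hypMoment, hypPoly, Nat.sub_self, pow_zero, mul_one, coeff_one_add_C_mul_X_pow,
    mul_div_cancel_left₀ _ this]

theorem hypPoly_mul (L : ℝ) {N₀ N₁ s₀ s₁ : ℕ} (h₀ : s₀ ≤ N₀) (h₁ : s₁ ≤ N₁) :
    hypPoly L N₀ s₀ * hypPoly L N₁ s₁ = hypPoly L (N₀ + N₁) (s₀ + s₁) := by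
  rw [hypPoly, hypPoly, hypPoly, show N₀ + N₁ - (s₀ + s₁) = (N₀ - s₀) + (N₁ - s₁) by omega,
    pow_add, pow_add]
  ring

/-- The numerators of the hypergeometric probability cancel the denominators of the moments, leaving
the convolution of coefficients. An inequality suffices, and it covers vanishing binomials, where `x
/ 0 = 0`. -/
theorem sum_hypPMF_mul_hypMoment_le {L : ℝ} (hL : 0 ≤ L) {N₀ N₁ s₀ s₁ : ℕ} (h₀ : s₀ ≤ N₀)
    (h₁ : s₁ ≤ N₁) (k : ℕ) :
    ∑ z ∈ Finset.range (k + 1), hypPMF (N₀ + N₁) N₀ k (z : ℕ) *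
      (hypMoment L N₀ s₀ z * hypMoment L N₁ s₁ (k - z)) ≤
      hypMoment L (N₀ + N₁) (s₀ + s₁) k := by
  rw [hypMoment, ← hypPoly_mul L h₀ h₁, coeff_mul, Finset.Nat.sum_antidiagonal_eq_sum_range_succ
    fun i j => (hypPoly L N₀ s₀).coeff i * (hypPoly L N₁ s₁).coeff j, Finset.sum_div]
  refine Finset.sum_le_sum fun z hz => ?_
  have hzk : z ≤ k := by simpa [Nat.lt_succ_iff] using hz
  have hc₀ := coeff_hypPoly_nonneg hL N₀ s₀ z
  have hc₁ := coeff_hypPoly_nonneg hL N₁ s₁ (k - z)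
  rw [hypPMF_natCast_of_le hzk, Nat.add_sub_cancel_left, hypMoment, hypMoment, div_mul_eq_mul_div]
  refine div_le_div_of_nonneg_right ?_ (Nat.cast_nonneg _)
  rw [mul_mul_mul_comm]
  have key : ∀ (c : ℕ) {x : ℝ}, 0 ≤ x → c * (x / c) ≤ x := by
    intro c x hx
    rcases eq_or_ne (c : ℝ) 0 with h | h
    · simpa [h] using hx
    · rw [mul_div_cancel₀ _ h]
  exact mul_le_mul (key _ hc₀) (key _ hc₁) (by positivity) hc₀

/-- Comparison with independent sampling, by removing one marked element: it contributes 1, plus `L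
- 1` if it is chosen. -/
theorem coeff_hypPoly_le {L : ℝ} (hL : 1 ≤ L) {N s : ℕ} (hs : s ≤ N) (m : ℕ) (hm : m ≤ N) :
    (hypPoly L N s).coeff m ≤ (1 + (L - 1) * (m / N)) ^ s * N.choose m := by
  induction s generalizing N m with
  | zero => simp [hypPoly, coeff_one_add_X_pow]
  | succ s ih =>
    obtain ⟨N, rfl⟩ : ∃ N', N = N' + 1 := ⟨N - 1, by omega⟩
    have e : hypPoly L (N + 1) (s + 1) =
        hypPoly L (N + 1) s + C (L - 1) * (X * hypPoly L N s) := by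
      rw [hypPoly, hypPoly, hypPoly, show N + 1 - s = (N - s) + 1 by omega,
        show N + 1 - (s + 1) = N - s by omega, pow_succ, pow_succ, C_sub, C_1]
      ring
    have h1 := ih (show s ≤ N + 1 by omega) m hm
    rw [e, coeff_add, coeff_C_mul]
    set q : ℝ := 1 + (L - 1) * (m / (N + 1 : ℕ)) with hq
    have hL' : 0 ≤ L - 1 := by linarith
    have hq1 : 0 ≤ q := by positivity
    rcases m with _ | m
    · simp only [coeff_X_mul_zero, mul_zero, add_zero]
      simp [hq] at h1 ⊢
      exact h1
    rw [coeff_X_mul]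
    have h2 := ih (show s ≤ N by omega) m (by omega)
    -- Negative correlation: choosing one element lowers the chance of each other one.
    have h3 : (m / N : ℝ) ≤ (m + 1 : ℕ) / (N + 1 : ℕ) := by
      rcases Nat.eq_zero_or_pos N with h0 | h0
      · subst h0; simp; positivity
      · have : (0 : ℝ) < N := by exact_mod_cast h0
        have hmN : (m : ℝ) ≤ N := by exact_mod_cast Nat.le_of_succ_le_succ hm
        push_cast
        rw [div_le_div_iff₀ this (by positivity)]
        nlinarith
    have h4 : (N.choose m : ℝ) = (m + 1 : ℕ) / (N + 1 : ℕ) * (N + 1).choose (m + 1) := by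
      have : ((N : ℝ) + 1) * N.choose m = (N + 1).choose (m + 1) * (m + 1) := by
        exact_mod_cast Nat.add_one_mul_choose_eq N m
      push_cast
      field_simp
      linarith
    have h5 : (hypPoly L N s).coeff m ≤ q ^ s * N.choose m := by
      refine h2.trans ?_
      have : 0 ≤ 1 + (L - 1) * ((m : ℝ) / N) := by positivity
      refine mul_le_mul_of_nonneg_right (pow_le_pow_left₀ this ?_ s) (Nat.cast_nonneg _)
      rw [hq]
      gcongr
    calc (hypPoly L (N + 1) s).coeff (m + 1) + (L - 1) * (hypPoly L N s).coeff m
        ≤ q ^ s * (N + 1).choose (m + 1) + (L - 1) * (q ^ s * N.choose m) :=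
          add_le_add h1 (mul_le_mul_of_nonneg_left h5 hL')
      _ = q ^ (s + 1) * (N + 1).choose (m + 1) := by
          rw [h4, pow_succ, hq]; ring

theorem hypMoment_le_exp {L : ℝ} (hL : 1 ≤ L) {N s : ℕ} (hs : s ≤ N) {m : ℕ} (hm : m ≤ N) :
    hypMoment L N s m ≤ Real.exp ((L - 1) * (m / N) * s) := by
  have hc : (0 : ℝ) < N.choose m := by exact_mod_cast Nat.choose_pos hm
  have hL' : 0 ≤ L - 1 := by linarith
  rw [hypMoment, div_le_iff₀ hc, mul_comm (_ * _) (s : ℝ), Real.exp_nat_mul]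
  refine (coeff_hypPoly_le hL hs m hm).trans (mul_le_mul_of_nonneg_right ?_ hc.le)
  refine pow_le_pow_left₀ (by positivity) ?_ s
  rw [add_comm]
  exact Real.add_one_le_exp _

end Moments

/-- A hypergeometric variate that splits `k` elements between sets of `N₀` and `N₁` elements, followed
by computations for both parts. -/
theorem meanLE_tsum_hypSample {L : ℝ} (hL : 0 ≤ L) (B : Block) (r : ℕ) {N N₀ N₁ s₀ s₁ k : ℕ}
    (hN : N = N₀ + N₁) (h₀ : s₀ ≤ N₀) (h₁ : s₁ ≤ N₁) (hk : k ≤ N) {T : Set SeedIndex}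
    (hT : Disjoint (drawSeeds B r) T) {f : ℕ → Source → ℝ≥0∞} {a : ℝ≥0∞}
    (hf : ∀ z ≤ N₀, z ≤ k → k - z ≤ N₁ →
      MeanLE T (f z) (a * ENNReal.ofReal (hypMoment L N₀ s₀ z * hypMoment L N₁ s₁ (k - z)))) :
    MeanLE (drawSeeds B r ∪ T)
      (fun ω => ∑' z, (hypSample (fun t j => (ω (B, r, t, j) : ℝ)) N N₀ k).weightAt z * f z ω)
      (38880 * a * ENNReal.ofReal (hypMoment L N (s₀ + s₁) k)) := by
  subst hN
  have hz : ∀ z, MeanLE (drawSeeds B r ∪ T)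
      (fun ω => (hypSample (fun t j => (ω (B, r, t, j) : ℝ)) (N₀ + N₁) N₀ k).weightAt z * f z ω)
      (38880 * a * ENNReal.ofReal (hypPMF (N₀ + N₁) N₀ k z *
        (hypMoment L N₀ s₀ z * hypMoment L N₁ s₁ (k - z)))) := by
    intro z
    have hs := meanLE_hypSample B r (show N₀ ≤ N₀ + N₁ by omega) hk z
    by_cases h : z ≤ N₀ ∧ z ≤ k ∧ k - z ≤ N₁
    · refine (hs.mul (hf z h.1 h.2.1 h.2.2) hT).mono subset_rfl Filter.EventuallyLE.rfl ?_
      rw [ENNReal.ofReal_mul (hypPMF_nonneg _ _ _ _)]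
      exact le_of_eq (by ring)
    · have h0 : hypPMF (N₀ + N₁) N₀ k z = 0 := by
        by_cases h2 : z ≤ N₀
        · by_cases h3 : z ≤ k
          · exact hypPMF_eq_zero_of_lt_sub (by omega)
          · exact hypPMF_natCast_of_lt (by omega)
        · exact hypPMF_eq_zero_of_lt (by omega)
      -- An impossible result has weight zero almost everywhere, so the trivial bound `⊤` for the
      -- continuation is enough.
      rw [h0] at hs ⊢
      have := hs.mul (meanLE_top T (f z)) hT
      simpa using this
  refine (MeanLE.tsum hz).mono subset_rfl Filter.EventuallyLE.rfl ?_
  rw [ENNReal.tsum_mul_left]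
  refine mul_le_mul' le_rfl ?_
  have hnn : ∀ z : ℕ, 0 ≤ hypPMF (N₀ + N₁) N₀ k z *
      (hypMoment L N₀ s₀ z * hypMoment L N₁ s₁ (k - z)) := fun z =>
    mul_nonneg (hypPMF_nonneg _ _ _ _) (mul_nonneg (hypMoment_nonneg hL _ _ _)
      (hypMoment_nonneg hL _ _ _))
  rw [tsum_eq_sum (s := Finset.range (k + 1)), ← ENNReal.ofReal_sum_of_nonneg fun z _ => hnn z]
  · exact ENNReal.ofReal_le_ofReal (sum_hypPMF_mul_hypMoment_le hL h₀ h₁ k)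
  · intro z hz
    rw [hypPMF_natCast_of_lt (by simpa [Nat.lt_succ_iff] using hz)]
    simp

/-! ### Geometry of the chunk matrix -/

theorem secStart_mono (n P : ℕ) : Monotone (secStart n P) := fun _ _ h =>
  Nat.div_le_div_right (Nat.mul_le_mul_right n h)

/-- Number of vertices of the sections `a, ..., a + l - 1`. -/
def verts (n P a l : ℕ) : ℕ := secStart n P (a + l) - secStart n P a

theorem verts_zero (n P a : ℕ) : verts n P a 0 = 0 := by simp [verts]

theorem verts_add (n P a l k : ℕ) :
    verts n P a (l + k) = verts n P a l + verts n P (a + l) k := by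
  have h1 := secStart_mono n P (show a ≤ a + l by omega)
  have h2 := secStart_mono n P (show a + l ≤ a + l + k by omega)
  unfold verts
  rw [← add_assoc]
  omega

theorem verts_split (n P a l : ℕ) :
    verts n P a l = verts n P a ((l + 1) / 2) + verts n P (a + (l + 1) / 2) (l - (l + 1) / 2) := by
  rw [← verts_add]; congr 1; omega

theorem verts_one_le {n P a l i : ℕ} (h : a ≤ i) (h' : i < a + l) :
    verts n P i 1 ≤ verts n P a l := by
  obtain ⟨x, rfl⟩ := Nat.exists_eq_add_of_le h
  obtain ⟨y, hy⟩ := Nat.exists_eq_add_of_le (show x + 1 ≤ l by omega)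
  rw [hy, verts_add, verts_add]
  omega

theorem choose_two_add (a b : ℕ) : (a + b).choose 2 = a.choose 2 + (b * a + b.choose 2) := by
  have := Nat.add_choose_eq a b 2
  rw [Finset.Nat.sum_antidiagonal_eq_sum_range_succ fun i j => a.choose i * b.choose j] at this
  rw [this, Finset.sum_range_succ, Finset.sum_range_succ, Finset.sum_range_succ]
  simp
  ring

namespace Block

theorem size_tri (n P a l : ℕ) : (tri a l).size n P = (verts n P a l).choose 2 := rfl

theorem size_rect (n P a l c k : ℕ) :
    (rect a l c k).size n P = verts n P a l * verts n P c k := rfl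

theorem size_quad (n P : ℕ) (B : Block) : B.size n P = (B.quad 0).size n P +
    ((B.quad 1).size n P + ((B.quad 2).size n P + (B.quad 3).size n P)) := by
  cases B with
  | tri a l =>
    simp only [quad, size_tri, size_rect, verts_zero]
    rw [verts_split n P a l, choose_two_add]
    ring
  | rect a l c k =>
    simp only [quad, size_rect]
    rw [verts_split n P a l, verts_split n P c k]
    ring

/-- Rectangular blocks lie below the diagonal and are almost square. -/
def WellFormed : Block → Prop
  | tri _ _ => True
  | rect a l c k => c + k ≤ a ∧ l ≤ k + 1 ∧ k ≤ l + 1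

theorem WellFormed.quad {B : Block} (h : B.WellFormed) (j : Fin 4) : (B.quad j).WellFormed := by
  cases B <;> fin_cases j <;> simp only [WellFormed, Block.quad] at * <;> omega

/-- Number of potential edges of processing element `i` in a block. -/
def own (n P i : ℕ) : Block → ℕ
  | tri a l => if a ≤ i ∧ i < a + l then
      verts n P i 1 * (verts n P a l - verts n P i 1) + (verts n P i 1).choose 2 else 0
  | rect a l c k => if a ≤ i ∧ i < a + l then verts n P i 1 * verts n P c k
      else if c ≤ i ∧ i < c + k then verts n P a l * verts n P i 1 else 0

theorem own_eq_zero {n P i : ℕ} {B : Block} (h : ¬ B.Meets i) : B.own n P i = 0 := by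
  cases B with
  | tri a l => exact if_neg h
  | rect a l c k =>
    simp only [Meets, not_or] at h
    rw [own]
    split_ifs with h1 h2
    · rw [show k = 0 by omega, verts_zero, mul_zero]
    · rw [show l = 0 by omega, verts_zero, zero_mul]
    · rfl

theorem own_le_size (n P i : ℕ) (B : Block) : B.own n P i ≤ B.size n P := by
  cases B with
  | tri a l =>
    rw [own, size_tri]
    split_ifs with h
    · obtain ⟨d, hd⟩ := Nat.exists_eq_add_of_le (verts_one_le (n := n) (P := P) h.1 h.2)
      rw [hd, choose_two_add, Nat.add_sub_cancel_left, mul_comm]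
      omega
    · exact Nat.zero_le _
  | rect a l c k =>
    rw [own, size_rect]
    split_ifs with h1 h2
    · exact Nat.mul_le_mul_right _ (verts_one_le h1.1 h1.2)
    · exact Nat.mul_le_mul_left _ (verts_one_le h2.1 h2.2)
    · exact Nat.zero_le _

theorem own_of_isChunk {n P i : ℕ} {B : Block} (h : B.Meets i) (h' : B.IsChunk) :
    B.own n P i = B.size n P := by
  cases B with
  | tri a l =>
    simp only [Meets, IsChunk] at h h'
    obtain ⟨rfl, rfl⟩ : l = 1 ∧ i = a := by omega
    rw [own, size_tri, if_pos (by omega)]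
    simp
  | rect a l c k =>
    simp only [Meets, IsChunk] at h h'
    obtain ⟨rfl, rfl⟩ := h'
    rw [own, size_rect]
    split_ifs with h1 h2
    · rw [show i = a by omega]
    · rw [show i = c by omega]
    · omega

theorem own_quad {n P i : ℕ} {B : Block} (hB : B.WellFormed) (h : B.Meets i) :
    B.own n P i = (B.quad 0).own n P i +
      ((B.quad 1).own n P i + ((B.quad 2).own n P i + (B.quad 3).own n P i)) := by
  cases B with
  | tri a l =>
    simp only [Meets] at h
    simp only [quad, own]
    rw [if_pos h, if_neg (show ¬(0 ≤ i ∧ i < 0 + 0) by omega),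
      if_neg (show ¬(0 ≤ i ∧ i < 0 + 0) by omega)]
    have hV := verts_split n P a l
    rcases lt_or_ge i (a + (l + 1) / 2) with h1 | h1
    · have hw := verts_one_le (n := n) (P := P) h.1 h1
      rw [if_pos (show a ≤ i ∧ i < a + (l + 1) / 2 by omega), if_neg (by omega), if_pos (by omega),
        if_neg (by omega), hV, Nat.sub_add_comm hw]
      ring
    · have hw := verts_one_le (n := n) (P := P) h1
        (show i < a + (l + 1) / 2 + (l - (l + 1) / 2) by omega)
      rw [if_neg (show ¬(a ≤ i ∧ i < a + (l + 1) / 2) by omega), if_pos (by omega),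
        if_pos (by omega), hV, Nat.add_sub_assoc hw]
      ring
  | rect a l c k =>
    simp only [Meets, WellFormed] at h hB
    simp only [quad, own]
    have hV := verts_split n P a l
    have hW := verts_split n P c k
    by_cases h0 : a ≤ i ∧ i < a + l
    · rw [if_pos h0]
      rcases lt_or_ge i (a + (l + 1) / 2) with h1 | h1
      · rw [if_pos (show a ≤ i ∧ i < a + (l + 1) / 2 by omega),
          if_pos (show a ≤ i ∧ i < a + (l + 1) / 2 by omega), if_neg (by omega), if_neg (by omega),
          if_neg (by omega), if_neg (by omega), hW]
        ring
      · rw [if_neg (show ¬(a ≤ i ∧ i < a + (l + 1) / 2) by omega), if_neg (by omega),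
          if_neg (show ¬(a ≤ i ∧ i < a + (l + 1) / 2) by omega), if_neg (by omega),
          if_pos (by omega), if_pos (by omega), hW]
        ring
    · have h2 : c ≤ i ∧ i < c + k := by omega
      have h3 : ¬(a ≤ i ∧ i < a + (l + 1) / 2) := by omega
      have h4 : ¬(a + (l + 1) / 2 ≤ i ∧ i < a + (l + 1) / 2 + (l - (l + 1) / 2)) := by omega
      simp only [if_neg h0, if_pos h2, if_neg h3, if_neg h4]
      rcases lt_or_ge i (c + (k + 1) / 2) with h1 | h1
      · have h5 : c ≤ i ∧ i < c + (k + 1) / 2 := ⟨h2.1, h1⟩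
        have h6 : ¬(c + (k + 1) / 2 ≤ i ∧ i < c + (k + 1) / 2 + (k - (k + 1) / 2)) := by omega
        rw [if_pos h5, if_neg h6, if_pos h5, if_neg h6, hV]
        ring
      · have h5 : ¬(c ≤ i ∧ i < c + (k + 1) / 2) := by omega
        have h6 : c + (k + 1) / 2 ≤ i ∧ i < c + (k + 1) / 2 + (k - (k + 1) / 2) := by omega
        rw [if_pos h6, if_neg h5, if_neg h5, if_pos h6, hV]
        ring

/-- Upper bound for the number of blocks that processing element `i` visits in the recursion on a
block. -/
def visits (i : ℕ) : Block → ℕ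
  | tri a l => if a ≤ i ∧ i < a + l then 6 * l else 0
  | rect a l c k => if a ≤ i ∧ i < a + l then min (3 * k - 1) (3 * k + l - 3) else
      if c ≤ i ∧ i < c + k then min (3 * l - 1) (3 * l + k - 3) else 0

theorem visits_eq_zero {i : ℕ} {B : Block} (hB : B.WellFormed) (h : ¬ B.Meets i) :
    B.visits i = 0 := by
  cases B <;> simp only [Meets, visits, WellFormed] at * <;> split_ifs <;> omega

theorem visits_pos {i : ℕ} {B : Block} (h : B.Meets i) : 1 ≤ B.visits i := by
  cases B <;> simp only [Meets, visits] at * <;> split_ifs <;> omega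

/-- When the element owns a row of a block with at least two rows and columns, the two visited
halves cost at most `3 * k - 2`, leaving one for the block itself. A single row is budgeted one
less, so that a chunk costs one. Near-squareness excludes long single columns, whose repeated
halving would exceed the budget. -/
theorem visits_quad_le {i : ℕ} {B : Block} (hB : B.WellFormed) (h : B.Meets i)
    (h' : ¬ B.IsChunk) : 1 + ((B.quad 0).visits i + ((B.quad 1).visits i + ((B.quad 2).visits i +
      (B.quad 3).visits i))) ≤ B.visits i := by
  cases B with
  | tri a l =>
    simp only [Meets, IsChunk] at h h'
    simp only [quad, visits]
    split_ifs <;> omega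
  | rect a l c k =>
    simp only [Meets, WellFormed, IsChunk] at h hB h'
    simp only [quad, visits]
    split_ifs <;> omega

/-- `B.Within B'`: the block `B` is a nonempty part of the block `B'`. -/
def Within : Block → Block → Prop
  | tri a l, tri a' l' => 0 < l ∧ a' ≤ a ∧ a + l ≤ a' + l'
  | tri _ _, rect _ _ _ _ => False
  | rect a l c k, tri a' l' => 0 < l ∧ 0 < k ∧ a' ≤ c ∧ c + k ≤ a ∧ a + l ≤ a' + l'
  | rect a l c k, rect a' l' c' k' =>
      0 < l ∧ 0 < k ∧ a' ≤ a ∧ a + l ≤ a' + l' ∧ c' ≤ c ∧ c + k ≤ c' + k'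

theorem Within.of_quad {B B' : Block} {j : Fin 4} (h : B'.Within (B.quad j)) : B'.Within B := by
  cases B <;> cases B' <;> fin_cases j <;> simp only [Within, quad] at * <;> omega

theorem within_self {B : Block} {i : ℕ} (h : B.Meets i) : B.Within B := by
  cases B <;> simp only [Within, Meets] at * <;> omega

theorem not_within_quad {B : Block} {i : ℕ} (h : B.Meets i) (h' : ¬ B.IsChunk) (j : Fin 4) :
    ¬ B.Within (B.quad j) := by
  intro hw
  cases B <;> fin_cases j <;> simp only [Within, Meets, IsChunk, quad] at * <;> omega

/-- Quadrants are disjoint as sets of chunks; the nonemptiness demanded by `Within` is essential, as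
an empty block would fit into several. -/
theorem not_within_of_within_quad {B B' : Block} {j j' : Fin 4} (hj : j < j')
    (h : B'.Within (B.quad j)) : ¬ B'.Within (B.quad j') := by
  intro h'
  cases B <;> cases B' <;> fin_cases j <;> fin_cases j' <;>
    first
    | (simp only [Within, quad] at h h'; done)
    | (simp only [Within, quad] at h h'; omega)

/-- The hash values that are used in the recursion on a block. -/
def seeds (B : Block) : Set SeedIndex := {x | x.1.Within B}

theorem seeds_quad_subset (B : Block) (j : Fin 4) : (B.quad j).seeds ⊆ B.seeds := fun _ hx =>
  Within.of_quad hx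

theorem drawSeeds_subset_seeds {B : Block} {i : ℕ} (h : B.Meets i) (r : ℕ) :
    drawSeeds B r ⊆ B.seeds := by
  intro x hx
  have := (mem_drawSeeds.1 hx).1
  change x.1.Within B
  rw [this]
  exact within_self h

theorem disjoint_seeds_quad (B : Block) {j j' : Fin 4} (h : j < j') :
    Disjoint (B.quad j).seeds (B.quad j').seeds :=
  Set.disjoint_left.2 fun _ hx hx' => not_within_of_within_quad h hx hx'

theorem disjoint_drawSeeds_seeds_quad {B : Block} {i : ℕ} (h : B.Meets i) (h' : ¬ B.IsChunk)
    (r : ℕ) (j : Fin 4) : Disjoint (drawSeeds B r) (B.quad j).seeds :=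
  Set.disjoint_left.2 fun x hx hx' => not_within_quad h h' j <| by
    rw [← (mem_drawSeeds.1 hx).1] at hx' ⊢
    exact hx'

end Block

/-! ### The recursion -/

/-- The exponential weight per sampled edge. -/
noncomputable def edgeWeight : ℝ := (81 / 80) ^ 14 * 6480

theorem one_le_edgeWeight : 1 ≤ edgeWeight := by
  rw [edgeWeight]; norm_num

theorem ofReal_edgeWeight : ENNReal.ofReal edgeWeight = rate ^ 14 * 6480 := by
  rw [edgeWeight, ENNReal.ofReal_mul (by positivity), rate, ENNReal.ofReal_pow (by norm_num),
    ENNReal.ofReal_ofNat]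

/-- The exponential weight per visited block. -/
noncomputable def blockWeight : ℝ≥0∞ := rate * 38880 ^ 3

theorem one_le_blockWeight : 1 ≤ blockWeight :=
  one_le_mul one_le_rate (one_le_pow₀ (by norm_num))

theorem rate_le_blockWeight : rate ≤ blockWeight :=
  le_mul_of_one_le_right' (one_le_pow₀ (by norm_num))

/-- The nesting makes each recursive call a factor with a fixed edge count, in the order in which
the three hypergeometric splits are analysed. -/
theorem expTime_peBlock {n P i : ℕ} {B : Block} (h : B.Meets i) (h' : ¬ B.IsChunk) (ω : Source)
    (k : ℕ) :
    expTime (peBlock n P i ω B k).time = rate *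
      ∑' z₀, (hypSample (fun t j => (ω (B, 0, t, j) : ℝ)) (B.size n P)
          ((B.quad 0).size n P) k).weightAt z₀ *
        (expTime (peBlock n P i ω (B.quad 0) z₀).time *
      ∑' z₁, (hypSample (fun t j => (ω (B, 1, t, j) : ℝ)) (B.size n P - (B.quad 0).size n P)
          ((B.quad 1).size n P) (k - z₀)).weightAt z₁ *
        (expTime (peBlock n P i ω (B.quad 1) z₁).time *
      ∑' z₂, (hypSample (fun t j => (ω (B, 2, t, j) : ℝ))
          (B.size n P - (B.quad 0).size n P - (B.quad 1).size n P)
          ((B.quad 2).size n P) (k - z₀ - z₁)).weightAt z₂ *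
        (expTime (peBlock n P i ω (B.quad 2) z₂).time *
          expTime (peBlock n P i ω (B.quad 3) (k - z₀ - z₁ - z₂)).time))) := by
  rw [peBlock, dif_pos h, dif_neg h', Timed.time_bind, expTime_add, time_tick, expTime_one,
    Timed.expTime_bind]
  congr 1
  refine tsum_congr fun z₀ => ?_
  congr 1
  rw [Timed.expTime_bind, ← ENNReal.tsum_mul_left]
  refine tsum_congr fun z₁ => ?_
  rw [Timed.expTime_bind, ← ENNReal.tsum_mul_left, ← ENNReal.tsum_mul_left,
    ← ENNReal.tsum_mul_left, ← ENNReal.tsum_mul_left]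
  refine tsum_congr fun z₂ => ?_
  simp only [Timed.time_bind, Timed.time_pure, expTime_add, add_zero]
  ring

/-- Owned entries add up over the quadrants, and hypergeometric splitting merges their moments. A
chunk is wholly owned and a block not met owns nothing, so both base cases have explicit moments. -/
theorem meanLE_peBlock {n P i : ℕ} (B : Block) (hB : B.WellFormed) (k : ℕ)
    (hk : k ≤ B.size n P) :
    MeanLE B.seeds (fun ω => expTime (peBlock n P i ω B k).time)
      (blockWeight ^ B.visits i *
        ENNReal.ofReal (hypMoment edgeWeight (B.size n P) (B.own n P i) k)) := by
  have hL : 0 ≤ edgeWeight := zero_le_one.trans one_le_edgeWeight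
  induction hw : B.weight using Nat.strong_induction_on generalizing B k with
  | _ w ih =>
  subst hw
  by_cases h : B.Meets i
  swap
  · have h1 : ∀ ω, expTime (peBlock n P i ω B k).time = 1 := fun ω => by
      rw [peBlock, dif_neg h, Timed.time_pure, expTime_zero]
    simp_rw [h1]
    rw [Block.visits_eq_zero hB h, Block.own_eq_zero h, hypMoment_zero _ hk]
    simpa using meanLE_const B.seeds 1
  by_cases h' : B.IsChunk
  · have h1 : ∀ ω, expTime (peBlock n P i ω B k).time = rate * expTime
        (methodD (fun r t j => (ω (B, r, t, j) : ℝ)) k (B.size n P) 0).time := fun ω => by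
      rw [peBlock, dif_pos h, dif_pos h', Timed.time_bind, expTime_add, time_tick, expTime_one,
        Timed.time_bind, Timed.time_pure, add_zero]
    simp_rw [h1]
    refine ((meanLE_methodD B k (B.size n P) 0).const_mul rate).mono
      (Set.iUnion_subset fun r => Block.drawSeeds_subset_seeds h r) Filter.EventuallyLE.rfl ?_
    rw [Block.own_of_isChunk h h', hypMoment_self _ hk, ENNReal.ofReal_pow hL, ofReal_edgeWeight]
    exact mul_le_mul' (rate_le_blockWeight.trans (le_self_pow₀ one_le_blockWeight
      (Nat.one_le_iff_ne_zero.1 (Block.visits_pos h)))) le_rfl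
  have ihq : ∀ (j : Fin 4) (z : ℕ), z ≤ (B.quad j).size n P → MeanLE (B.quad j).seeds
      (fun ω => expTime (peBlock n P i ω (B.quad j) z).time)
      (blockWeight ^ (B.quad j).visits i * ENNReal.ofReal
        (hypMoment edgeWeight ((B.quad j).size n P) ((B.quad j).own n P i) z)) := fun j z hz =>
    ih _ (Block.weight_quad_lt h h' j) _ (hB.quad j) z hz rfl
  have hs := Block.size_quad n P B
  have ho := Block.own_quad (n := n) (P := P) hB h
  have hle := fun j => Block.own_le_size n P i (B.quad j)
  have hnn := fun j z => hypMoment_nonneg hL ((B.quad j).size n P) ((B.quad j).own n P i) z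
  have hdq := fun r j => Block.disjoint_drawSeeds_seeds_quad h h' r j
  have hd01 := Block.disjoint_seeds_quad B (show (0 : Fin 4) < 1 by decide)
  have hd02 := Block.disjoint_seeds_quad B (show (0 : Fin 4) < 2 by decide)
  have hd03 := Block.disjoint_seeds_quad B (show (0 : Fin 4) < 3 by decide)
  have hd12 := Block.disjoint_seeds_quad B (show (1 : Fin 4) < 2 by decide)
  have hd13 := Block.disjoint_seeds_quad B (show (1 : Fin 4) < 3 by decide)
  have hd23 := Block.disjoint_seeds_quad B (show (2 : Fin 4) < 3 by decide)
  have hr01 := disjoint_drawSeeds B (show (0 : ℕ) ≠ 1 by decide)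
  have hr02 := disjoint_drawSeeds B (show (0 : ℕ) ≠ 2 by decide)
  have hr12 := disjoint_drawSeeds B (show (1 : ℕ) ≠ 2 by decide)
  -- The draws are integrated from the innermost outwards, each separating one quadrant from all
  -- later ones.
  have key₂ := fun (k' : ℕ) (hk' : k' ≤ (B.quad 2).size n P + (B.quad 3).size n P) =>
    meanLE_tsum_hypSample hL B 2 (N := (B.quad 2).size n P + (B.quad 3).size n P)
      (s₀ := (B.quad 2).own n P i) (s₁ := (B.quad 3).own n P i) rfl (hle 2) (hle 3) hk'
      (T := (B.quad 2).seeds ∪ (B.quad 3).seeds)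
      (Set.disjoint_union_right.2 ⟨hdq 2 2, hdq 2 3⟩)
      (f := fun z ω => expTime (peBlock n P i ω (B.quad 2) z).time *
        expTime (peBlock n P i ω (B.quad 3) (k' - z)).time)
      (a := blockWeight ^ (B.quad 2).visits i * blockWeight ^ (B.quad 3).visits i)
      (fun z hz _ hz' => ((ihq 2 z hz).mul (ihq 3 (k' - z) hz') hd23).mono subset_rfl
        Filter.EventuallyLE.rfl (by
          rw [ENNReal.ofReal_mul (hnn 2 z)]; exact le_of_eq (by ring)))
  have key₁ := fun (k' : ℕ) (hk' : k' ≤ (B.quad 1).size n P +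
      ((B.quad 2).size n P + (B.quad 3).size n P)) =>
    meanLE_tsum_hypSample hL B 1
      (N := (B.quad 1).size n P + ((B.quad 2).size n P + (B.quad 3).size n P))
      (s₀ := (B.quad 1).own n P i) (s₁ := (B.quad 2).own n P i + (B.quad 3).own n P i)
      rfl (hle 1) (add_le_add (hle 2) (hle 3)) hk'
      (T := (B.quad 1).seeds ∪ (drawSeeds B 2 ∪ ((B.quad 2).seeds ∪ (B.quad 3).seeds)))
      (by simp only [Set.disjoint_union_right]; exact ⟨hdq 1 1, hr12, hdq 1 2, hdq 1 3⟩)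
      (f := fun z ω => expTime (peBlock n P i ω (B.quad 1) z).time * _)
      (a := blockWeight ^ (B.quad 1).visits i * (38880 *
        (blockWeight ^ (B.quad 2).visits i * blockWeight ^ (B.quad 3).visits i)))
      (fun z hz _ hz' => ((ihq 1 z hz).mul (key₂ (k' - z) hz')
        (by simp only [Set.disjoint_union_right]; exact ⟨(hdq 2 1).symm, hd12, hd13⟩)).mono
        subset_rfl Filter.EventuallyLE.rfl (by
          rw [ENNReal.ofReal_mul (hnn 1 z)]; exact le_of_eq (by ring)))
  have key₀ := meanLE_tsum_hypSample hL B 0 hs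
      (s₀ := (B.quad 0).own n P i) (s₁ := (B.quad 1).own n P i +
        ((B.quad 2).own n P i + (B.quad 3).own n P i))
      (hle 0) (add_le_add (hle 1) (add_le_add (hle 2) (hle 3))) hk
      (T := (B.quad 0).seeds ∪ (drawSeeds B 1 ∪
        ((B.quad 1).seeds ∪ (drawSeeds B 2 ∪ ((B.quad 2).seeds ∪ (B.quad 3).seeds)))))
      (by
        simp only [Set.disjoint_union_right]
        exact ⟨hdq 0 0, hr01, hdq 0 1, hr02, hdq 0 2, hdq 0 3⟩)
      (f := fun z ω => expTime (peBlock n P i ω (B.quad 0) z).time * _)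
      (a := blockWeight ^ (B.quad 0).visits i * (38880 * (blockWeight ^ (B.quad 1).visits i *
        (38880 * (blockWeight ^ (B.quad 2).visits i * blockWeight ^ (B.quad 3).visits i)))))
      (fun z hz _ hz' => ((ihq 0 z hz).mul (key₁ (k - z) hz') (by
        simp only [Set.disjoint_union_right]
        exact ⟨(hdq 1 0).symm, hd01, (hdq 2 0).symm, hd02, hd03⟩)).mono
        subset_rfl Filter.EventuallyLE.rfl (by
          rw [ENNReal.ofReal_mul (hnn 0 z)]; exact le_of_eq (by ring)))
  have e1 : B.size n P - (B.quad 0).size n P =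
      (B.quad 1).size n P + ((B.quad 2).size n P + (B.quad 3).size n P) := by omega
  have e2 : B.size n P - (B.quad 0).size n P - (B.quad 1).size n P =
      (B.quad 2).size n P + (B.quad 3).size n P := by omega
  refine (key₀.const_mul rate).mono ?_ (Filter.Eventually.of_forall fun ω => ?_) ?_
  · simp only [Set.union_subset_iff]
    have hd := Block.drawSeeds_subset_seeds h
    have hq := Block.seeds_quad_subset B
    exact ⟨hd 0, hq 0, hd 1, hq 1, hd 2, hq 2, hq 3⟩
  · refine le_of_eq ((expTime_peBlock h h' ω k).trans ?_)
    rw [e2, e1]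
  · rw [← ho]
    calc _ = blockWeight ^ (1 + ((B.quad 0).visits i + ((B.quad 1).visits i +
            ((B.quad 2).visits i + (B.quad 3).visits i)))) *
          ENNReal.ofReal (hypMoment edgeWeight (B.size n P) (B.own n P i) k) := by
          rw [pow_add, pow_one, pow_add, pow_add, pow_add]
          -- The fifth occurrence is the factor for the block itself, which pays one tick and three
          -- draws.
          nth_rewrite 5 [blockWeight]
          ring
      _ ≤ _ := mul_le_mul' (pow_le_pow_right₀ one_le_blockWeight
          (Block.visits_quad_le hB h h')) le_rfl

/-! ### The running time of the generator -/

theorem time_outputVertices (len v : ℕ) : (outputVertices len v).time = len := by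
  induction len generalizing v with
  | zero => simp [outputVertices, Timed.time_pure]
  | succ len ih =>
    rw [outputVertices, Timed.time_bind, time_tick, Timed.time_bind, ih, Timed.time_pure, add_zero,
      add_comm, Nat.cast_succ]

theorem verts_one_le_div (n i : ℕ) {P : ℕ} (hP : 1 ≤ P) :
    (verts n P i 1 : ℝ) ≤ (n : ℝ) / P + 1 := by
  have hP' : (0 : ℝ) < P := by exact_mod_cast hP
  rw [verts, Nat.cast_sub (secStart_mono n P (Nat.le_succ i)), secStart, secStart]
  have h1 : (((i + 1) * n / P : ℕ) : ℝ) ≤ (i + 1) * n / P := by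
    exact_mod_cast Nat.cast_div_le (α := ℝ) (m := (i + 1) * n) (n := P)
  have h2 : (i : ℝ) * n / P < ((i * n / P : ℕ) : ℝ) + 1 := by
    rw [div_lt_iff₀ hP']
    have := (Nat.lt_mul_div_succ (i * n) hP).trans_eq (mul_comm _ _)
    exact_mod_cast this
  have h3 : ((i : ℝ) + 1) * n / P = i * n / P + n / P := by ring
  linarith

theorem verts_all (n : ℕ) {P : ℕ} (hP : 1 ≤ P) : verts n P 0 P = n := by
  rw [verts, secStart, secStart]
  simp [Nat.mul_div_cancel_left n hP]

theorem own_tri_le {n P i : ℕ} (hP : 1 ≤ P) (hi : i < P) :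
    (Block.own n P i (Block.tri 0 P) : ℝ) ≤ verts n P i 1 * ((n : ℝ) - 1) := by
  have hw : verts n P i 1 ≤ n :=
    (verts_one_le (Nat.zero_le i) (by omega)).trans_eq (verts_all n hP)
  rw [Block.own, if_pos (by omega), verts_all n hP, Nat.cast_add, Nat.cast_mul, Nat.cast_sub hw,
    Nat.cast_choose_two]
  rcases Nat.eq_zero_or_pos (verts n P i 1) with h | h
  · simp [h]
  · have : (1 : ℝ) ≤ verts n P i 1 := by exact_mod_cast h
    -- For `v` own vertices the claim is `v * (n - v) + v * (v - 1) / 2 ≤ v * (n - 1)`, which for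
    -- integers needs only `v ≥ 1` here.
    nlinarith

theorem expected_edges_le {n m P i : ℕ} (hP : 1 ≤ P) (hm : m ≤ n.choose 2) (hi : i < P) :
    (m : ℝ) / (n.choose 2 : ℕ) * Block.own n P i (Block.tri 0 P) ≤ 4 * ((m : ℝ) / P) + P := by
  have hP' : (0 : ℝ) < P := by exact_mod_cast hP
  rcases lt_or_ge n 2 with hn | hn
  · obtain rfl : m = 0 := by simpa [Nat.choose_eq_zero_of_lt hn] using hm
    simp
  have hn' : (2 : ℝ) ≤ n := by exact_mod_cast hn
  have hm' : (m : ℝ) ≤ n * (n - 1) / 2 := by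
    rw [← Nat.cast_choose_two]; exact_mod_cast hm
  rw [Nat.cast_choose_two]
  have h1 : (0 : ℝ) < n * (n - 1) / 2 := by nlinarith
  calc (m : ℝ) / (n * (n - 1) / 2) * Block.own n P i (Block.tri 0 P)
      ≤ m / (n * (n - 1) / 2) * ((n / P + 1) * ((n : ℝ) - 1)) := by
        refine mul_le_mul_of_nonneg_left ((own_tri_le hP hi).trans ?_) (by positivity)
        exact mul_le_mul_of_nonneg_right (verts_one_le_div n i hP) (by linarith)
    _ = 2 * (m / P) + 2 * m / n := by
        have : (n : ℝ) - 1 ≠ 0 := by linarith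
        field_simp
    _ ≤ 4 * (m / P) + P := by
        -- The rounding error `2 * m / n` is absorbed by `2 * m / P` if `P ≤ n`; otherwise it is at
        -- most `n - 1 < P`.
        rcases le_or_gt (P : ℝ) n with h | h
        · have h2 : (m : ℝ) / n ≤ m / P := div_le_div_of_nonneg_left (Nat.cast_nonneg _) hP' h
          rw [mul_div_assoc]
          linarith
        · have h2 : 2 * (m : ℝ) / n ≤ n - 1 := by
            rw [div_le_iff₀ (by linarith)]; linarith
          have h3 : (0 : ℝ) ≤ m / P := by positivity
          linarith

/-! ### Markov's inequality and the tail of the running time -/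

theorem MeanLE.measure_ge_le {S : Set SeedIndex} {f : Source → ℝ≥0∞} {c R : ℝ≥0∞}
    (h : MeanLE S f c) (h0 : R ≠ 0) (h1 : R ≠ ⊤) : hashMeasure {ω | R ≤ f ω} ≤ c / R := by
  obtain ⟨g, hg, hfg, hgc⟩ := h
  calc hashMeasure {ω | R ≤ f ω} ≤ hashMeasure {ω | R ≤ g ω} :=
        measure_mono_ae (by filter_upwards [hfg] with ω h1 h2 using le_trans h2 h1)
    _ ≤ (∫⁻ ω, g ω ∂hashMeasure) / R :=
        meas_ge_le_lintegral_div (hg.mono (seedAlgebra_le S) le_rfl).aemeasurable h0 h1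
    _ ≤ c / R := ENNReal.div_le_div_right hgc R

/-- Base of the exponential bound for the expected weight of the running time. -/
noncomputable def momentRate : ℝ :=
  Real.log (81 / 80) + 6 * Real.log (81 / 80 * 38880 ^ 3) + 4 * (edgeWeight - 1)

theorem blockWeight_eq : blockWeight = ENNReal.ofReal (81 / 80 * 38880 ^ 3) := by
  rw [blockWeight, rate, ENNReal.ofReal_mul (by norm_num), ENNReal.ofReal_pow (by norm_num),
    ENNReal.ofReal_ofNat]

theorem meanLE_peRun {n m P i : ℕ} (hP : 1 ≤ P) (hm : m ≤ n.choose 2) (hi : i < P) :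
    MeanLE (Block.tri 0 P).seeds (fun ω => expTime (peRun n m P i ω).time)
      (ENNReal.ofReal (Real.exp (momentRate * (((n : ℝ) + m) / P + P)))) := by
  have hsize : (Block.tri 0 P).size n P = n.choose 2 := by
    rw [Block.size_tri, verts_all n hP]
  have h := (meanLE_peBlock (n := n) (P := P) (i := i) (Block.tri 0 P) trivial m
    (hm.trans_eq hsize.symm)).const_mul (rate ^ verts n P i 1)
  refine h.mono subset_rfl (Filter.Eventually.of_forall fun ω => le_of_eq ?_) ?_
  · simp only [peRun, Timed.time_bind, Timed.time_pure, add_zero, expTime_add, time_outputVertices,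
      expTime_natCast]
    rfl
  have hv : (Block.tri 0 P).visits i = 6 * P := by
    rw [Block.visits, if_pos (by omega)]
  have hP' : (1 : ℝ) ≤ P := by exact_mod_cast hP
  have hn0 : (0 : ℝ) ≤ (n : ℝ) / P := by positivity
  have hm0 : (0 : ℝ) ≤ (m : ℝ) / P := by positivity
  have hmom := hypMoment_le_exp one_le_edgeWeight (Block.own_le_size n P i (Block.tri 0 P))
    (hm.trans_eq hsize.symm)
  have hedge := expected_edges_le hP hm hi
  have hL : 0 ≤ edgeWeight - 1 := by linarith [one_le_edgeWeight]
  have hr : 0 ≤ Real.log (81 / 80) := Real.log_nonneg (by norm_num)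
  have hA : 0 ≤ Real.log (81 / 80 * 38880 ^ 3) := Real.log_nonneg (by norm_num)
  have e1 : (81 / 80 : ℝ) = Real.exp (Real.log (81 / 80)) := (Real.exp_log (by norm_num)).symm
  have e2 : (81 / 80 * 38880 ^ 3 : ℝ) = Real.exp (Real.log (81 / 80 * 38880 ^ 3)) :=
    (Real.exp_log (by norm_num)).symm
  rw [hv, blockWeight_eq, rate, ← ENNReal.ofReal_pow (by norm_num),
    ← ENNReal.ofReal_pow (by norm_num), ← ENNReal.ofReal_mul (by positivity),
    ← ENNReal.ofReal_mul (by positivity)]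
  refine ENNReal.ofReal_le_ofReal ?_
  rw [hsize] at hmom ⊢
  rw [e2, e1, ← Real.exp_nat_mul, ← Real.exp_nat_mul, ← e1]
  refine (mul_le_mul_of_nonneg_left (mul_le_mul_of_nonneg_left hmom (by positivity))
    (by positivity)).trans ?_
  rw [← Real.exp_add, ← Real.exp_add, Real.exp_le_exp, momentRate, mul_assoc (edgeWeight - 1),
    add_div]
  -- The three summands of `momentRate` pay for output vertices, visited blocks and sampled edges;
  -- `1 ≤ P` absorbs the rounding term.
  have h1 := mul_le_mul_of_nonneg_right (verts_one_le_div n i hP) hr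
  have h2 := mul_le_mul_of_nonneg_left hedge hL
  have h3 := mul_nonneg hA hn0
  have h4 := mul_nonneg hA hm0
  have h5 := mul_nonneg hr hm0
  have h6 := mul_le_mul_of_nonneg_left hP' hr
  have h7 := mul_nonneg hL hn0
  have h8 := mul_le_mul_of_nonneg_left hP' hL
  push_cast
  nlinarith

/-- With this constant the threshold has weight `exp ((momentRate + c + 1) * x)`, so Markov leaves
`exp (-(c + 1) * x)`, and `x ≥ P ≥ log P`. The extra one in the exponent pays for the union bound.
-/
theorem measure_peRun_le {n m P i : ℕ} (hP : 1 ≤ P) (hm : m ≤ n.choose 2) (hi : i < P) {c : ℝ}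
    (hc : 0 < c) :
    hashMeasure {ω | ENNReal.ofReal ((momentRate + (c + 1)) / Real.log (81 / 80) *
        (((n : ℝ) + m) / P + P)) < ((peRun n m P i ω).time : ℝ≥0∞)} ≤
      ENNReal.ofReal ((P : ℝ) ^ (-(c + 1))) := by
  have hr : 0 < Real.log (81 / 80) := Real.log_pos (by norm_num)
  have hP' : (1 : ℝ) ≤ P := by exact_mod_cast hP
  set x : ℝ := ((n : ℝ) + m) / P + P with hx
  have hPx : (P : ℝ) ≤ x := by
    have : 0 ≤ ((n : ℝ) + m) / P := by positivity
    linarith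
  set R : ℝ := Real.exp ((momentRate + (c + 1)) * x) with hR
  have hRpos : 0 < R := Real.exp_pos _
  have hsub : {ω | ENNReal.ofReal ((momentRate + (c + 1)) / Real.log (81 / 80) * x) <
      ((peRun n m P i ω).time : ℝ≥0∞)} ⊆
      {ω | ENNReal.ofReal R ≤ expTime (peRun n m P i ω).time} := by
    intro ω hω
    rw [Set.mem_ofPred_eq] at hω ⊢
    revert hω
    induction (peRun n m P i ω).time using ENat.recTopCoe with
    | top => simp
    | coe t =>
      intro hω
      have ht : t ≠ 0 := by
        rintro rfl
        simp at hω
      rw [ENat.toENNReal_coe, ENNReal.ofReal_lt_natCast ht] at hω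
      rw [expTime_natCast, rate, ← ENNReal.ofReal_pow (by norm_num)]
      refine ENNReal.ofReal_le_ofReal ?_
      rw [← Real.exp_log (show (0 : ℝ) < 81 / 80 by norm_num), ← Real.exp_nat_mul, hR,
        Real.exp_le_exp]
      rw [div_mul_eq_mul_div, div_lt_iff₀ hr] at hω
      exact hω.le
  refine (measure_mono hsub).trans (((meanLE_peRun hP hm hi).measure_ge_le
    (by simpa using hRpos) ENNReal.ofReal_ne_top).trans ?_)
  rw [← ENNReal.ofReal_div_of_pos hRpos, hR, ← Real.exp_sub]
  refine ENNReal.ofReal_le_ofReal ?_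
  rw [Real.rpow_def_of_pos (by linarith), Real.exp_le_exp]
  have h1 : Real.log P ≤ x := (Real.log_le_self (by linarith)).trans hPx
  nlinarith

theorem runningTime_gt_subset (n m P : ℕ) (t : ℝ≥0∞) :
    {ω | t < (runningTime n m P ω : ℝ≥0∞)} ⊆
      ⋃ i : Fin P, {ω | t < ((peRun n m P i ω).time : ℝ≥0∞)} := by
  intro ω hω
  rw [Set.mem_ofPred_eq, runningTime, ENat.toENNReal_iSup, lt_iSup_iff] at hω
  exact Set.mem_iUnion.2 hω

end ERGen

theorem mainTheorem4 (c : ℝ) (hc : 0 < c) :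
    ∃ C : ℝ, 0 < C ∧ ∀ n m P : ℕ, 1 ≤ P → m ≤ n.choose 2 →
      ERGen.hashMeasure
          {ω | ENNReal.ofReal (C * (((n : ℝ) + m) / P + P)) < (ERGen.runningTime n m P ω : ℝ≥0∞)}
        ≤ ENNReal.ofReal ((P : ℝ) ^ (-c)) := by
  have hr : 0 < Real.log (81 / 80) := Real.log_pos (by norm_num)
  have hrate : 0 ≤ ERGen.momentRate := by
    have h1 : 0 ≤ Real.log (81 / 80 * 38880 ^ 3) := Real.log_nonneg (by norm_num)
    have h2 := ERGen.one_le_edgeWeight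
    unfold ERGen.momentRate
    linarith
  refine ⟨(ERGen.momentRate + (c + 1)) / Real.log (81 / 80), by positivity, ?_⟩
  intro n m P hP hm
  have hP' : (0 : ℝ) < P := by exact_mod_cast hP
  refine (measure_mono (ERGen.runningTime_gt_subset n m P _)).trans
    ((measure_iUnion_le _).trans ?_)
  rw [tsum_fintype]
  refine (Finset.sum_le_sum fun i _ => ERGen.measure_peRun_le hP hm i.2 hc).trans (le_of_eq ?_)
  rw [Finset.sum_const, Finset.card_univ, Fintype.card_fin, nsmul_eq_mul,
    ← ENNReal.ofReal_natCast, ← ENNReal.ofReal_mul hP'.le]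
  congr 1
  -- The union bound multiplies by `P = P ^ 1`, raising the exponent from `-(c + 1)` to `-c`.
  nth_rewrite 1 [← Real.rpow_one (P : ℝ)]
  rw [← Real.rpow_add hP']
  congr 1
  ring
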